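/- Let $A\in\mathbb{R}^{m\times n}$ be non-degenerate (full column rank and no zero row), let $b\in\mathbb{R}^m$, and suppose that the open polyhedron $\Omega^\circ=\{x\in\mathbb{R}^n : Ax>b\}$ is non-empty. For $x\in\Omega^\circ$ put $A_x=\mathrm{Diag}(Ax-b)^{-1}A$. Fix $q>0$ and, with $W=\mathrm{Diag}(w)$, define \[ f(x,w)=\log\det\bigl(A_x^\top W^{1-\frac2q}A_x\bigr)-\Bigl(1-\frac2q\Bigr)\sum_{i=1}^m w_i , \qquad \psi(x)=\begin{cases}\max_{w\in\mathbb{R}^m,\,w\ge 0}\tfrac12 f(x,w) & \text{if } q\ge 2,\\[2pt] \min_{w\in\mathbb{R}^m,\,w\ge 0}\tfrac12 f(x,w) & \text{if } q\le 2,\end{cases} \] where $f(x,w)=-\infty$ if $q>2$ and $A_x^\top W^{1-2/q}A_x$ is singular, $f(x,w)=+\infty$ if $q<2$ and some $w_i=0$, and $W^0=I$ if $q=2$ (then $f$ does not depend on $w$). Then for every $x\in\Omega^\circ$ the maximum, respectively minimum, is attained at a finite value, and $\psi:\Omega^\circ\to\mathbb{R}$ is a barrier function for $\Omega^\circ$: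 it is convex and three times continuously differentiable, and $\psi(x_k)\to+\infty$ for every sequence $x_k\in\Omega^\circ$ that converges to a point of the boundary of $\Omega^\circ$. For all $x\in\Omega^\circ$ and $h\in\mathbb{R}^n$ the Hessian $\nabla^2\psi(x)$ is positive definite and, with $\|h\|_{\nabla^2\psi(x)}=(h^\top\nabla^2\psi(x)h)^{1/2}$, 1. $\nabla\psi(x)^\top\,\nabla^2\psi(x)^{-1}\,\nabla\psi(x)\le n$; 2. $|D^3\psi(x)[h,h,h]|\le 2v_q\,\|h\|_{\nabla^2\psi(x)}^{3}$, where $v_q=(q+2)^{3/2}m^{\frac1{q+2}}+4\max\{q,2\}^{5/2}$. Consequently $\phi=v_q^2\psi$ is a $\nu$-self-concordant barrier for $\Omega^\circ$ with $\nu=n v_q^2$; that is, $\phi$ is a barrier function for $\Omega^\circ$ in the above sense and, for all $x\in\Omega^\circ$ and $h\in\mathbb{R}^n$, $|D^3\phi(x)[h,h,h]|\le 2|D^2\phi(x)[h,h]|^{3/2}$ and $|D\phi(x)[h]|\le\sqrt{\nu}\,|D^2\phi(x)[h,h]|^{1/2}$. -/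

import Mathlib

open Filter Topology
open scoped Matrix

noncomputable section

namespace LewisBarrier

/-- Full column rank and no zero rows. -/
def NonDegenerate {m n : ℕ} (A : Matrix (Fin m) (Fin n) ℝ) : Prop :=
  A.rank = n ∧ ∀ i, A i ≠ 0

/-- The open polyhedron `{x | A x > b}`. -/
def interiorSet {m n : ℕ} (A : Matrix (Fin m) (Fin n) ℝ) (b : Fin m → ℝ) :
    Set (Fin n → ℝ) :=
  {x | ∀ i, b i < (A *ᵥ x) i}

/-- `A_x = S_x⁻¹ A` with `S_x = Diag (A x - b)`. -/
def scaledMatrix {m n : ℕ} (A : Matrix (Fin m) (Fin n) ℝ) (b : Fin m → ℝ)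
    (x : Fin n → ℝ) : Matrix (Fin m) (Fin n) ℝ :=
  Matrix.diagonal (fun i => ((A *ᵥ x) i - b i)⁻¹) * A

/-- `Mᵀ W^(1 - 2/q) M` with `W = Diag w`. -/
def weightedGram {m n : ℕ} (q : ℝ) (M : Matrix (Fin m) (Fin n) ℝ) (w : Fin m → ℝ) :
    Matrix (Fin n) (Fin n) ℝ :=
  Mᵀ * Matrix.diagonal (fun i => w i ^ (1 - 2 / q)) * M

/-- `f(x, w) = log det (A_xᵀ W^(1 - 2/q) A_x) - (1 - 2/q) ∑ i, w i`. -/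
def potential {m n : ℕ} (q : ℝ) (A : Matrix (Fin m) (Fin n) ℝ) (b : Fin m → ℝ)
    (x : Fin n → ℝ) (w : Fin m → ℝ) : ℝ :=
  Real.log (weightedGram q (scaledMatrix A b x) w).det - (1 - 2 / q) * ∑ i, w i

/-- The weights `w ≥ 0` at which `f(x, w)` is a finite real number.
For `q > 2` a weight with singular Gram matrix has `f = -∞`, and for `q < 2` a weight with a zero
entry has `f = +∞` because of the negative exponent `1 - 2/q`; neither can be an optimizer, and
both are left out so that the values of `Real.log` and `Real.rpow` at `0` do not enter. -/
def admissibleWeights {m n : ℕ} (q : ℝ) (A : Matrix (Fin m) (Fin n) ℝ) (b : Fin m → ℝ)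
    (x : Fin n → ℝ) : Set (Fin m → ℝ) :=
  {w | (∀ i, 0 ≤ w i) ∧ (q < 2 → ∀ i, 0 < w i) ∧
    0 < (weightedGram q (scaledMatrix A b x) w).det}

/-- The set of values `f(x, w) / 2` over the weights `w ≥ 0`. -/
def barrierValues {m n : ℕ} (q : ℝ) (A : Matrix (Fin m) (Fin n) ℝ) (b : Fin m → ℝ)
    (x : Fin n → ℝ) : Set ℝ :=
  (fun w => (1 / 2 : ℝ) * potential q A b x w) '' admissibleWeights q A b x

open Classical in
/-- The Lewis weight barrier `ψ`: the largest value of `f(x, ·) / 2` if `q ≥ 2`,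
the smallest one if `q ≤ 2` (for `q = 2` there is only one value). -/
def barrier {m n : ℕ} (q : ℝ) (A : Matrix (Fin m) (Fin n) ℝ) (b : Fin m → ℝ)
    (x : Fin n → ℝ) : ℝ :=
  if 2 ≤ q then sSup (barrierValues q A b x) else sInf (barrierValues q A b x)

/-- The gradient as the vector of partial derivatives. -/
def grad {n : ℕ} (φ : (Fin n → ℝ) → ℝ) (x : Fin n → ℝ) : Fin n → ℝ :=
  fun i => fderiv ℝ φ x (Pi.single i 1)

/-- The Hessian as the matrix of second partial derivatives. -/
def hess {n : ℕ} (φ : (Fin n → ℝ) → ℝ) (x : Fin n → ℝ) : Matrix (Fin n) (Fin n) ℝ :=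
  Matrix.of fun i j => iteratedFDeriv ℝ 2 φ x ![Pi.single i 1, Pi.single j 1]

/-- `φ` tends to `+∞` along every sequence in `K` that converges to a boundary point of `K`. -/
def BlowsUpAtBoundary {n : ℕ} (K : Set (Fin n → ℝ)) (φ : (Fin n → ℝ) → ℝ) : Prop :=
  ∀ u : ℕ → (Fin n → ℝ), (∀ k, u k ∈ K) →
    ∀ p ∈ frontier K, Tendsto u atTop (𝓝 p) → Tendsto (fun k => φ (u k)) atTop atTop

/-- Barrier functions for an open convex set: convex, thrice continuously differentiable, and
tending to `+∞` at the boundary. -/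
structure IsBarrier {n : ℕ} (K : Set (Fin n → ℝ)) (φ : (Fin n → ℝ) → ℝ) : Prop where
  isOpen : IsOpen K
  convexOn : ConvexOn ℝ K φ
  contDiffOn : ContDiffOn ℝ 3 φ K
  blowsUp : BlowsUpAtBoundary K φ

/-- `ν`-self-concordant barrier functions for the open convex set `K`. -/
structure IsSelfConcordantBarrier {n : ℕ} (ν : ℝ) (K : Set (Fin n → ℝ))
    (φ : (Fin n → ℝ) → ℝ) : Prop extends IsBarrier K φ where
  third_le : ∀ x ∈ K, ∀ h : Fin n → ℝ,
    |iteratedFDeriv ℝ 3 φ x ![h, h, h]| ≤ 2 * |iteratedFDeriv ℝ 2 φ x ![h, h]| ^ (3 / 2 : ℝ)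
  first_le : ∀ x ∈ K, ∀ h : Fin n → ℝ,
    |fderiv ℝ φ x h| ≤ √ν * |iteratedFDeriv ℝ 2 φ x ![h, h]| ^ (1 / 2 : ℝ)

/-- `v_q = (q + 2)^(3/2) m^(1/(q + 2)) + 4 max{q, 2}^(5/2)`. -/
def concordanceConst (q : ℝ) (m : ℕ) : ℝ :=
  (q + 2) ^ (3 / 2 : ℝ) * (m : ℝ) ^ (1 / (q + 2)) + 4 * (max q 2) ^ (5 / 2 : ℝ)

end LewisBarrier

end

/-!
Write a positive weight as `w = lev A l`, the leverage scores of `diag(e^(l/2)) A`. The critical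
points of `f(x, ·)` are the solutions of `l - (1 - 2/q) log (lev A l) = -2 log (A x - b)`. The
left-hand side `lewisMap` is a proper local diffeomorphism, hence solutions exist and can be chosen
smoothly in `x`; concavity (or convexity, in logarithmic coordinates) of `f(x, ·)` makes them global
optimizers.

Along a line the derivatives of the barrier are therefore explicit in terms of the orthogonal
projection `P` onto the range of `diag(e^(l/2)) A` and its Hadamard square `P ⊙ P`, which satisfies
`0 ≤ P ⊙ P ≤ diag P`. The velocities of `l` and of the weights drop out of the first derivative
because the weights are critical. The Hessian dominates `∑ wᵢ yᵢ²`, where `y` is the velocity of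
`log (A x - b)`; together with `∑ wᵢ = n` this gives the bound on the gradient, and together with
`|yᵢ| ≤ m^(1/(q+2)) (∑ wⱼ yⱼ²)^(1/2)` the bound on the third derivative. At the boundary the tangent
plane of the convex function `l ↦ log det (Aᵀ diag(e^l) A)` at `l = 0` bounds the barrier below by a
positive combination of the `-log (A x - b)ᵢ`.
-/

noncomputable section

namespace LewisBarrier

section StarProjection

variable {ι : Type*} [Fintype ι] {P : Matrix ι ι ℝ}

theorem transpose_starProjection (hP : IsStarProjection P) : Pᵀ = P := by
  simpa [Matrix.star_eq_conjTranspose] using hP.isSelfAdjoint.star_eq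

theorem starProjection_apply_comm (hP : IsStarProjection P) (i j : ι) : P i j = P j i :=
  congrFun (congrFun (transpose_starProjection hP) j) i

theorem sum_starProjection_apply_sq (hP : IsStarProjection P) (i : ι) :
    ∑ j, P i j ^ 2 = P i i := by
  conv_rhs => rw [← hP.isIdempotentElem.eq, Matrix.mul_apply]
  exact Finset.sum_congr rfl fun j _ => by rw [starProjection_apply_comm hP j i, sq]

theorem starProjection_self_nonneg (hP : IsStarProjection P) (i : ι) : 0 ≤ P i i := by
  rw [← sum_starProjection_apply_sq hP]
  exact Finset.sum_nonneg fun j _ => sq_nonneg _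

theorem sum_starProjection_self_mul_sq_nonneg (hP : IsStarProjection P) (z : ι → ℝ) :
    0 ≤ ∑ i, P i i * z i ^ 2 :=
  Finset.sum_nonneg fun i _ => mul_nonneg (starProjection_self_nonneg hP i) (sq_nonneg _)

theorem starProjection_mulVec_sq_le (hP : IsStarProjection P) (u : ι → ℝ) (i : ι) :
    (P *ᵥ u) i ^ 2 ≤ P i i * (u ⬝ᵥ u) := by
  have h := Finset.sum_mul_sq_le_sq_mul_sq Finset.univ (P i) u
  rw [sum_starProjection_apply_sq hP] at h
  simpa only [Matrix.mulVec, dotProduct, ← sq] using h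

theorem starProjection_apply_sq_le (hP : IsStarProjection P) (i j : ι) :
    P i j ^ 2 ≤ P i i * P j j := by
  have h : (P * P) i j ^ 2 ≤ P i i * (Pᵀ j ⬝ᵥ Pᵀ j) := starProjection_mulVec_sq_le hP (Pᵀ j) i
  rw [hP.isIdempotentElem.eq, transpose_starProjection hP] at h
  simpa only [dotProduct, ← sq, sum_starProjection_apply_sq hP] using h

theorem starProjection_self_le_one (hP : IsStarProjection P) (i : ι) : P i i ≤ 1 := by
  have h : P i i ^ 2 ≤ ∑ j, P i j ^ 2 :=
    Finset.single_le_sum (f := fun j => P i j ^ 2) (fun _ _ => sq_nonneg _) (Finset.mem_univ i)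
  rw [sum_starProjection_apply_sq hP] at h
  nlinarith [starProjection_self_nonneg hP i]

theorem hadamard_self_mulVec_apply (z : ι → ℝ) (i : ι) :
    ((P ⊙ P) *ᵥ z) i = ∑ j, P i j ^ 2 * z j := by
  simp only [Matrix.mulVec, dotProduct, Matrix.hadamard_apply, sq]

theorem hadamard_self_mulVec_sq_le (hP : IsStarProjection P) (z : ι → ℝ) (i : ι) :
    ((P ⊙ P) *ᵥ z) i ^ 2 ≤ P i i ^ 2 * ∑ j, P j j * z j ^ 2 := by
  calc ((P ⊙ P) *ᵥ z) i ^ 2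
      ≤ (∑ j, P i j ^ 2) * ∑ j, P i j ^ 2 * z j ^ 2 := by
        rw [hadamard_self_mulVec_apply]
        exact Finset.sum_sq_le_sum_mul_sum_of_sq_le_mul _ (fun _ _ => sq_nonneg _)
          (fun _ _ => by positivity) fun _ _ => by ring_nf; rfl
    _ ≤ P i i * ∑ j, P i i * P j j * z j ^ 2 := by
        rw [sum_starProjection_apply_sq hP]
        gcongr with j
        · exact starProjection_self_nonneg hP i
        · exact starProjection_apply_sq_le hP i j
    _ = P i i ^ 2 * ∑ j, P j j * z j ^ 2 := by
        simp only [Finset.mul_sum, sq, mul_assoc]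

theorem dotProduct_hadamard_self_mulVec_comm (hP : IsStarProjection P) (u z : ι → ℝ) :
    u ⬝ᵥ (P ⊙ P) *ᵥ z = z ⬝ᵥ (P ⊙ P) *ᵥ u := by
  rw [Matrix.dotProduct_mulVec, ← Matrix.mulVec_transpose, Matrix.transpose_hadamard,
    transpose_starProjection hP, dotProduct_comm]

theorem dotProduct_hadamard_self_mulVec_le (hP : IsStarProjection P) (z : ι → ℝ) :
    z ⬝ᵥ (P ⊙ P) *ᵥ z ≤ ∑ i, P i i * z i ^ 2 := by
  have hrow : ∑ i, ∑ j, P i j ^ 2 * z i ^ 2 = ∑ i, P i i * z i ^ 2 :=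
    Finset.sum_congr rfl fun i _ => by rw [← Finset.sum_mul, sum_starProjection_apply_sq hP]
  have hcol : ∑ i, ∑ j, P i j ^ 2 * z j ^ 2 = ∑ i, P i i * z i ^ 2 := by
    rw [Finset.sum_comm, ← hrow]
    simp only [starProjection_apply_comm hP]
  have hdiff : ∑ i, ∑ j, P i j ^ 2 * (z i - z j) ^ 2 =
      2 * (∑ i, P i i * z i ^ 2 - z ⬝ᵥ (P ⊙ P) *ᵥ z) := by
    calc ∑ i, ∑ j, P i j ^ 2 * (z i - z j) ^ 2
        = ∑ i, ∑ j, P i j ^ 2 * z i ^ 2 + ∑ i, ∑ j, P i j ^ 2 * z j ^ 2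
            - 2 * ∑ i, ∑ j, z i * (P i j ^ 2 * z j) := by
          simp only [Finset.mul_sum, ← Finset.sum_add_distrib, ← Finset.sum_sub_distrib]
          exact Finset.sum_congr rfl fun i _ => Finset.sum_congr rfl fun j _ => by ring
      _ = 2 * (∑ i, P i i * z i ^ 2 - z ⬝ᵥ (P ⊙ P) *ᵥ z) := by
          simp only [hrow, hcol, dotProduct, hadamard_self_mulVec_apply, ← Finset.mul_sum]
          ring
  have hnonneg : 0 ≤ ∑ i, ∑ j, P i j ^ 2 * (z i - z j) ^ 2 :=
    Finset.sum_nonneg fun i _ => Finset.sum_nonneg fun j _ => by positivity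
  linarith

variable [DecidableEq ι]

/-- The compression `P diag(z) P` of a diagonal matrix to the range of the projection `P`. Its
squared entries sum to the quadratic form of `P ⊙ P` at `z`. -/
def compression (P : Matrix ι ι ℝ) (z : ι → ℝ) : Matrix ι ι ℝ :=
  P * Matrix.diagonal z * P

theorem compression_apply (z : ι → ℝ) (i j : ι) :
    compression P z i j = ∑ k, P i k * z k * P k j := by
  rw [compression, Matrix.mul_apply]
  simp only [Matrix.mul_diagonal]

theorem compression_apply_comm (hP : IsStarProjection P) (z : ι → ℝ) (i j : ι) :
    compression P z i j = compression P z j i := by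
  simp only [compression_apply, starProjection_apply_comm hP i, starProjection_apply_comm hP _ j]
  exact Finset.sum_congr rfl fun k _ => by ring

theorem compression_mul_self (hP : IsStarProjection P) (z : ι → ℝ) :
    compression P z * compression P z = P * Matrix.diagonal z * compression P z := by
  simp only [compression, Matrix.mul_assoc, ← Matrix.mul_assoc P P, hP.isIdempotentElem.eq]

theorem sum_mul_compression (hP : IsStarProjection P) (z : ι → ℝ) (i : ι) :
    ∑ j, P i j * z j * compression P z i j = ∑ j, compression P z i j ^ 2 := by
  have h := congrFun (congrFun (compression_mul_self hP z) i) i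
  rw [Matrix.mul_apply, Matrix.mul_apply] at h
  simpa only [Matrix.mul_diagonal, compression_apply_comm hP z _ i, ← sq] using h.symm

theorem dotProduct_hadamard_self_mulVec (hP : IsStarProjection P) (z : ι → ℝ) :
    z ⬝ᵥ (P ⊙ P) *ᵥ z = ∑ i, ∑ j, compression P z i j ^ 2 := by
  calc z ⬝ᵥ (P ⊙ P) *ᵥ z = (P * Matrix.diagonal z * P * Matrix.diagonal z).trace := by
        rw [Matrix.trace_mul_comm, Matrix.dotProduct_mulVec, Matrix.dotProduct_vecMul_hadamard,
          Matrix.transpose_mul, transpose_starProjection hP, Matrix.diagonal_transpose]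
        simp only [Matrix.mul_assoc]
    _ = (compression P z * compression P z).trace := by
        rw [compression_mul_self hP, compression, ← Matrix.mul_assoc, Matrix.trace_mul_comm _ P]
        simp only [← Matrix.mul_assoc, hP.isIdempotentElem.eq]
    _ = ∑ i, ∑ j, compression P z i j ^ 2 := by
        simp only [Matrix.trace, Matrix.diag, Matrix.mul_apply, sq,
          compression_apply_comm hP z _ (_ : ι)]

omit [DecidableEq ι] in
theorem dotProduct_hadamard_self_mulVec_nonneg (hP : IsStarProjection P) (z : ι → ℝ) :
    0 ≤ z ⬝ᵥ (P ⊙ P) *ᵥ z := by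
  classical
  rw [dotProduct_hadamard_self_mulVec hP]
  exact Finset.sum_nonneg fun i _ => Finset.sum_nonneg fun j _ => sq_nonneg _

/-- The cubic form `tr (diag(z) P diag(z) P diag(z) P)` of a projection `P`, written so that it is
visibly dominated by the quadratic form of `P ⊙ P`. -/
def cubicForm (P : Matrix ι ι ℝ) (z : ι → ℝ) : ℝ :=
  ∑ i, z i * ∑ j, compression P z i j ^ 2

theorem abs_cubicForm_le (hP : IsStarProjection P) {z : ι → ℝ} {c : ℝ} (hz : ∀ i, |z i| ≤ c) :
    |cubicForm P z| ≤ c * (z ⬝ᵥ (P ⊙ P) *ᵥ z) := by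
  rw [dotProduct_hadamard_self_mulVec hP, Finset.mul_sum]
  refine (Finset.abs_sum_le_sum_abs _ _).trans (Finset.sum_le_sum fun i _ => ?_)
  have hrow : 0 ≤ ∑ j, compression P z i j ^ 2 := Finset.sum_nonneg fun j _ => sq_nonneg _
  rw [abs_mul, abs_of_nonneg hrow]
  exact mul_le_mul_of_nonneg_right (hz i) hrow

end StarProjection

section WeightedSums

variable {ι : Type*} [Fintype ι]

theorem sum_mul_rpow_inv_le {p : ℝ} (hp : 1 ≤ p) {w c : ι → ℝ} (hw : ∀ i, 0 ≤ w i)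
    (hc : ∀ i, 0 ≤ c i) (h : ∀ i, c i ≤ ∑ j, w j * c j) :
    (∑ j, w j * c j) ^ p⁻¹ ≤
      (Fintype.card ι : ℝ) ^ (1 - p⁻¹) * (∑ j, w j ^ p * c j) ^ p⁻¹ := by
  set E := ∑ j, w j * c j
  set Z := ∑ j, w j ^ p * c j
  set N := (Fintype.card ι : ℝ)
  have hp0 : 0 < p := one_pos.trans_le hp
  have hp' : 0 ≤ 1 - p⁻¹ := sub_nonneg.mpr (inv_le_one_of_one_le₀ hp)
  have hE : 0 ≤ E := Finset.sum_nonneg fun j _ => mul_nonneg (hw j) (hc j)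
  have hZ : 0 ≤ Z :=
    Finset.sum_nonneg fun j _ => mul_nonneg (Real.rpow_nonneg (hw j) p) (hc j)
  have hE_holder : E ≤ (N * E) ^ (1 - p⁻¹) * Z ^ p⁻¹ := by
    calc E = ∑ j, c j * w j := Finset.sum_congr rfl fun j _ => mul_comm _ _
      _ ≤ (∑ j, c j) ^ (1 - p⁻¹) * (∑ j, c j * w j ^ p) ^ p⁻¹ :=
        Real.inner_le_weight_mul_Lp_of_nonneg _ hp c w hc hw
      _ ≤ (N * E) ^ (1 - p⁻¹) * Z ^ p⁻¹ := by
        simp only [mul_comm (c _)]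
        gcongr
        · exact Finset.sum_nonneg fun j _ => hc j
        · exact (Finset.sum_le_sum fun j _ => h j).trans_eq (by simp [N])
  rcases hE.eq_or_lt with hE0 | hE0
  · rw [← hE0, Real.zero_rpow (inv_pos.mpr hp0).ne']
    positivity
  · refine le_of_mul_le_mul_left ?_ (Real.rpow_pos_of_pos hE0 (1 - p⁻¹))
    calc E ^ (1 - p⁻¹) * E ^ p⁻¹ = E := by rw [← Real.rpow_add hE0]; simp
      _ ≤ _ := hE_holder
      _ = _ := by rw [Real.mul_rpow (Nat.cast_nonneg _) hE]; ring

theorem rpow_mul_le_card_rpow_mul_sum {p : ℝ} (hp : 1 ≤ p) {w c : ι → ℝ} (hw : ∀ i, 0 ≤ w i)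
    (hc : ∀ i, 0 ≤ c i) (h : ∀ i, c i ≤ ∑ j, w j * c j) (i : ι) :
    w i ^ (p - 1) * c i ≤ (Fintype.card ι : ℝ) ^ (1 - p⁻¹) * ∑ j, w j ^ p * c j := by
  set E := ∑ j, w j * c j
  set Z := ∑ j, w j ^ p * c j
  set N := (Fintype.card ι : ℝ)
  have hp' : 0 ≤ 1 - p⁻¹ := sub_nonneg.mpr (inv_le_one_of_one_le₀ hp)
  have hwc : ∀ j, 0 ≤ w j ^ p * c j := fun j => mul_nonneg (Real.rpow_nonneg (hw j) p) (hc j)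
  have hZ : 0 ≤ Z := Finset.sum_nonneg fun j _ => hwc j
  calc w i ^ (p - 1) * c i = (w i ^ p * c i) ^ (1 - p⁻¹) * c i ^ p⁻¹ := by
        have hexp : p * (1 - p⁻¹) = p - 1 := by
          rw [mul_sub, mul_one, mul_inv_cancel₀ (one_pos.trans_le hp).ne']
        rw [Real.mul_rpow (Real.rpow_nonneg (hw i) p) (hc i), ← Real.rpow_mul (hw i), hexp,
          mul_assoc, ← Real.rpow_add' (hc i) (by simp)]
        simp
    _ ≤ Z ^ (1 - p⁻¹) * E ^ p⁻¹ := by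
        gcongr
        · exact Real.rpow_nonneg (hc i) _
        · exact hwc i
        · exact Finset.single_le_sum (fun j _ => hwc j) (Finset.mem_univ i)
        · exact hc i
        · exact h i
    _ ≤ Z ^ (1 - p⁻¹) * (N ^ (1 - p⁻¹) * Z ^ p⁻¹) := by
        gcongr
        exact sum_mul_rpow_inv_le hp hw hc h
    _ = N ^ (1 - p⁻¹) * (Z ^ (1 - p⁻¹) * Z ^ p⁻¹) := by ring
    _ = N ^ (1 - p⁻¹) * Z := by rw [← Real.rpow_add' hZ (by simp)]; simp

theorem abs_sum_mul_mul_mul_le {w a f g : ι → ℝ} {C F G : ℝ} (hw : ∀ i, 0 ≤ w i)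
    (ha : ∀ i, |a i| ≤ C) (hC : 0 ≤ C) (hF : 0 ≤ F) (hG : 0 ≤ G)
    (hf : ∑ i, w i * f i ^ 2 ≤ F ^ 2) (hg : ∑ i, w i * g i ^ 2 ≤ G ^ 2) :
    |∑ i, w i * (a i * f i * g i)| ≤ C * (F * G) := by
  refine abs_le_of_sq_le_sq ?_ (by positivity)
  calc (∑ i, w i * (a i * f i * g i)) ^ 2
      ≤ (∑ i, C ^ 2 * (w i * f i ^ 2)) * ∑ i, w i * g i ^ 2 := by
        refine Finset.sum_sq_le_sum_mul_sum_of_sq_le_mul _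
          (fun i _ => by have := hw i; positivity) (fun i _ => by have := hw i; positivity)
          fun i _ => ?_
        calc (w i * (a i * f i * g i)) ^ 2 = a i ^ 2 * (w i * f i * g i) ^ 2 := by ring
          _ ≤ C ^ 2 * (w i * f i * g i) ^ 2 := by
            gcongr ?_ * _
            exact sq_le_sq' (abs_le.mp (ha i)).1 (abs_le.mp (ha i)).2
          _ = _ := by ring
    _ ≤ C ^ 2 * F ^ 2 * G ^ 2 := by
        rw [← Finset.mul_sum]
        gcongr
        exact Finset.sum_nonneg fun i _ => mul_nonneg (hw i) (sq_nonneg _)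
    _ = (C * (F * G)) ^ 2 := by ring

end WeightedSums

section Velocity

variable {ι : Type*} [Fintype ι]

/-- The linear relations satisfied by the logarithmic derivatives along a line: `y` of the slacks,
`ρ` of the Lewis weights and `z` of the squared row norms of the rescaled matrix, where `P` is the
projection whose diagonal consists of the Lewis weights. -/
structure LewisVelocity (P : Matrix ι ι ℝ) (q : ℝ) (y z ρ : ι → ℝ) : Prop where
  hadamard_mulVec : ∀ i, ((P ⊙ P) *ᵥ z) i = P i i * (z i - ρ i)
  eq_sub : ∀ i, z i = (1 - 2 / q) * ρ i - 2 * y i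

namespace LewisVelocity

variable {P : Matrix ι ι ℝ} {q : ℝ} {y z ρ : ι → ℝ}

theorem dotProduct_hadamard_mulVec (hV : LewisVelocity P q y z ρ) (u : ι → ℝ) :
    u ⬝ᵥ (P ⊙ P) *ᵥ z = ∑ i, P i i * (u i * (z i - ρ i)) :=
  Finset.sum_congr rfl fun i _ => by rw [hV.hadamard_mulVec]; ring

theorem sum_mul_le_sum_sq (hP : IsStarProjection P) (hV : LewisVelocity P q y z ρ) :
    ∑ i, P i i * (z i * ρ i) ≤ ∑ i, P i i * z i ^ 2 := by
  classical
  have h := dotProduct_hadamard_self_mulVec_nonneg hP z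
  rw [hV.dotProduct_hadamard_mulVec] at h
  rw [← sub_nonneg, ← Finset.sum_sub_distrib]
  exact h.trans_eq (Finset.sum_congr rfl fun i _ => by ring)

theorem sum_sq_le_sum_mul (hP : IsStarProjection P) (hV : LewisVelocity P q y z ρ) :
    ∑ i, P i i * ρ i ^ 2 ≤ ∑ i, P i i * (z i * ρ i) := by
  classical
  have hρ := dotProduct_hadamard_self_mulVec_nonneg hP ρ
  have hu := dotProduct_hadamard_self_mulVec_le hP (z - ρ)
  have hsplit : ∑ i, P i i * (ρ i * (z i - ρ i)) =
      ρ ⬝ᵥ (P ⊙ P) *ᵥ ρ +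
        (∑ i, P i i * (z - ρ) i ^ 2 - (z - ρ) ⬝ᵥ (P ⊙ P) *ᵥ (z - ρ)) := by
    have hcross : (z - ρ) ⬝ᵥ (P ⊙ P) *ᵥ z = ∑ i, P i i * (z - ρ) i ^ 2 := by
      rw [hV.dotProduct_hadamard_mulVec]
      exact Finset.sum_congr rfl fun i _ => by rw [Pi.sub_apply, sq]
    have hcomm := dotProduct_hadamard_self_mulVec_comm hP z ρ
    rw [← hV.dotProduct_hadamard_mulVec, ← hcross]
    simp only [Matrix.mulVec_sub, dotProduct_sub, sub_dotProduct]
    linarith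
  have hnonneg : 0 ≤ ∑ i, P i i * (ρ i * (z i - ρ i)) := by rw [hsplit]; linarith
  rw [← sub_nonneg, ← Finset.sum_sub_distrib]
  exact hnonneg.trans_eq (Finset.sum_congr rfl fun i _ => by ring)

theorem abs_sub_le (hP : IsStarProjection P) (hP0 : ∀ i, 0 < P i i)
    (hV : LewisVelocity P q y z ρ) (i : ι) : |z i - ρ i| ≤ √(∑ j, P j j * z j ^ 2) := by
  have h := hadamard_self_mulVec_sq_le hP z i
  rw [hV.hadamard_mulVec, mul_pow] at h
  exact Real.abs_le_sqrt (le_of_mul_le_mul_left h (pow_pos (hP0 i) 2))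

/-- The second derivative of the barrier along a line, in terms of the velocities. -/
def second (P : Matrix ι ι ℝ) (y ρ : ι → ℝ) : ℝ :=
  ∑ i, P i i * (y i ^ 2 - ρ i * y i)

theorem two_mul_mul_eq (hq : q ≠ 0) (hV : LewisVelocity P q y z ρ) (i : ι) :
    2 * (q * y i) = (q - 2) * ρ i - q * z i := by
  rw [hV.eq_sub i]
  field_simp
  ring

theorem four_mul_second (hq : q ≠ 0) (hV : LewisVelocity P q y z ρ) :
    4 * q ^ 2 * second P y ρ = q ^ 2 * ∑ i, P i i * z i ^ 2 +
      4 * q * ∑ i, P i i * (z i * ρ i) - (q ^ 2 - 4) * ∑ i, P i i * ρ i ^ 2 := by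
  simp only [second, Finset.mul_sum, ← Finset.sum_add_distrib, ← Finset.sum_sub_distrib]
  refine Finset.sum_congr rfl fun i _ => ?_
  linear_combination P i i * (2 * (q * y i) - (q + 2) * ρ i - q * z i) * hV.two_mul_mul_eq hq i

theorem four_mul_sum_slack_sq (hq : q ≠ 0) (hV : LewisVelocity P q y z ρ) :
    4 * q ^ 2 * ∑ i, P i i * y i ^ 2 = q ^ 2 * ∑ i, P i i * z i ^ 2 -
      2 * q * (q - 2) * ∑ i, P i i * (z i * ρ i) + (q - 2) ^ 2 * ∑ i, P i i * ρ i ^ 2 := by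
  simp only [Finset.mul_sum, ← Finset.sum_add_distrib, ← Finset.sum_sub_distrib]
  refine Finset.sum_congr rfl fun i _ => ?_
  linear_combination P i i * (2 * (q * y i) + (q - 2) * ρ i - q * z i) * hV.two_mul_mul_eq hq i

section Bounds

variable (hP : IsStarProjection P) (hq : 0 < q) (hV : LewisVelocity P q y z ρ)
include hP hq hV

theorem sum_slack_sq_le : ∑ i, P i i * y i ^ 2 ≤ second P y ρ := by
  refine le_of_mul_le_mul_left ?_ (by positivity : 0 < 4 * q ^ 2)
  rw [hV.four_mul_second hq.ne', hV.four_mul_sum_slack_sq hq.ne']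
  nlinarith [mul_nonneg (sq_nonneg q) (sub_nonneg.mpr (hV.sum_sq_le_sum_mul hP)),
    mul_nonneg hq.le (sum_starProjection_self_mul_sq_nonneg hP ρ)]

theorem second_nonneg : 0 ≤ second P y ρ :=
  (sum_starProjection_self_mul_sq_nonneg hP y).trans (hV.sum_slack_sq_le hP hq)

theorem sum_weight_sq_le : ∑ i, P i i * ρ i ^ 2 ≤ q ^ 2 / (q + 1) * second P y ρ := by
  have hRC := hV.sum_sq_le_sum_mul hP
  have hCZ := hV.sum_mul_le_sum_sq hP
  rw [div_mul_eq_mul_div, le_div_iff₀ (by linarith)]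
  nlinarith [hV.four_mul_second hq.ne', mul_nonneg hq.le (sub_nonneg.mpr hRC),
    mul_nonneg (sq_nonneg q) (sub_nonneg.mpr (hRC.trans hCZ))]

theorem dotProduct_hadamard_mulVec_le : z ⬝ᵥ (P ⊙ P) *ᵥ z ≤ 4 * second P y ρ := by
  have hexpand : z ⬝ᵥ (P ⊙ P) *ᵥ z = ∑ i, P i i * z i ^ 2 - ∑ i, P i i * (z i * ρ i) := by
    rw [hV.dotProduct_hadamard_mulVec, ← Finset.sum_sub_distrib]
    exact Finset.sum_congr rfl fun i _ => by ring
  have hR := sum_starProjection_self_mul_sq_nonneg hP ρ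
  have hRC := hV.sum_sq_le_sum_mul hP
  refine le_of_mul_le_mul_left ?_ (by positivity : 0 < q ^ 2)
  rw [hexpand]
  nlinarith [hV.four_mul_second hq.ne', mul_nonneg (sq_nonneg q) (sub_nonneg.mpr hRC),
    mul_nonneg hq.le (hR.trans hRC), hR]

theorem sum_sub_sq_le : ∑ i, P i i * (z i - ρ i) ^ 2 ≤ 4 * second P y ρ := by
  have hexpand : ∑ i, P i i * (z i - ρ i) ^ 2 =
      ∑ i, P i i * z i ^ 2 - 2 * ∑ i, P i i * (z i * ρ i) + ∑ i, P i i * ρ i ^ 2 := by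
    rw [Finset.mul_sum, ← Finset.sum_sub_distrib, ← Finset.sum_add_distrib]
    exact Finset.sum_congr rfl fun i _ => by ring
  have hR := sum_starProjection_self_mul_sq_nonneg hP ρ
  have hRC := hV.sum_sq_le_sum_mul hP
  refine le_of_mul_le_mul_left ?_ (by positivity : 0 < q ^ 2)
  rw [hexpand]
  nlinarith [hV.four_mul_second hq.ne', mul_nonneg (sq_nonneg q) (sub_nonneg.mpr hRC),
    mul_nonneg hq.le (hR.trans hRC), hR]

theorem sum_sq_le : ∑ i, P i i * z i ^ 2 ≤ max q 2 ^ 2 * second P y ρ := by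
  have hR := sum_starProjection_self_mul_sq_nonneg hP ρ
  have hRC := hV.sum_sq_le_sum_mul hP
  have hCZ := hV.sum_mul_le_sum_sq hP
  have hS := hV.four_mul_second hq.ne'
  rcases le_total 2 q with h | h
  · rw [max_eq_left h]
    nlinarith [mul_nonneg (by nlinarith : 0 ≤ q ^ 2 - 4) (sub_nonneg.mpr (hRC.trans hCZ)),
      mul_nonneg hq.le (hR.trans hRC)]
  · rw [max_eq_right h]
    refine le_of_mul_le_mul_left ?_ (by positivity : 0 < q ^ 2)
    nlinarith [mul_nonneg (by nlinarith : 0 ≤ 4 - q ^ 2) hR, mul_nonneg hq.le (hR.trans hRC)]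

theorem abs_sub_le_mul_sqrt_second (hP0 : ∀ i, 0 < P i i) (i : ι) :
    |z i - ρ i| ≤ max q 2 * √(second P y ρ) := by
  have hmax : 0 ≤ max q 2 := hq.le.trans (le_max_left q 2)
  refine (hV.abs_sub_le hP hP0 i).trans ((Real.sqrt_le_sqrt (hV.sum_sq_le hP hq)).trans_eq ?_)
  rw [Real.sqrt_mul (sq_nonneg _), Real.sqrt_sq hmax]

end Bounds

end LewisVelocity

end Velocity

section Coefficients

theorem rpow_three_halves {a : ℝ} (ha : 0 ≤ a) : a ^ (3 / 2 : ℝ) = √a ^ 3 := by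
  rw [Real.sqrt_eq_rpow, ← Real.rpow_mul_natCast ha]
  norm_num

theorem rpow_five_halves {a : ℝ} (ha : 0 ≤ a) : a ^ (5 / 2 : ℝ) = √a ^ 5 := by
  rw [Real.sqrt_eq_rpow, ← Real.rpow_mul_natCast ha]
  norm_num

variable {q d : ℝ}

theorem concordance_coeff_slack_le (hq : 0 < q) (hd : d ^ 2 = q ^ 2 / (q + 1)) :
    3 * d + 2 + d ^ 2 + 4 * q ≤ 2 * (q + 2) ^ (3 / 2 : ℝ) := by
  have hd_le : 3 * d ≤ q + 9 / 4 * (q / (q + 1)) := by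
    have hsq : 9 / 4 * (q / (q + 1)) * (4 * q) = (3 * d) ^ 2 := by
      rw [mul_pow, hd]
      ring
    refine abs_le_of_sq_le_sq' ?_ (by positivity) |>.2
    nlinarith [sq_nonneg (q - 9 / 4 * (q / (q + 1)))]
  have hlinear : q + 9 / 4 * (q / (q + 1)) + 2 + d ^ 2 + 4 * q ≤ 4 + 6 * q := by
    rw [hd, ← sub_nonneg]
    have hdiff : 4 + 6 * q - (q + 9 / 4 * (q / (q + 1)) + 2 + q ^ 2 / (q + 1) + 4 * q) =
        (2 + 3 / 4 * q) / (q + 1) := by field_simp; ring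
    rw [hdiff]
    positivity
  have hcubic : 4 + 6 * q ≤ 2 * √(q + 2) ^ 3 := by
    have hsq : √(q + 2) ^ 2 = q + 2 := Real.sq_sqrt (by linarith)
    have hfactor : 0 ≤ (√(q + 2) - 2) ^ 2 * (√(q + 2) + 1) := by positivity
    linear_combination 2 * hfactor - 6 * hsq
  rw [rpow_three_halves (by linarith)]
  linarith

theorem concordance_coeff_max_le (hq : 0 < q) (hd : d ^ 2 = q ^ 2 / (q + 1)) :
    max q 2 * (d ^ 2 / 2 + 3 * d + 4 + 2 * |q - 2|) ≤ 8 * max q 2 ^ (5 / 2 : ℝ) := by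
  have hM2 : 2 ≤ max q 2 := le_max_right _ _
  have hMq : q ≤ max q 2 := le_max_left _ _
  generalize max q 2 = M at *
  obtain ⟨μ, hμ, rfl⟩ : ∃ μ, 0 ≤ μ ∧ μ ^ 2 = M :=
    ⟨√M, Real.sqrt_nonneg _, Real.sq_sqrt (by linarith)⟩
  have hdM : d ^ 2 ≤ μ ^ 2 := by
    rw [hd, div_le_iff₀ (by linarith)]
    nlinarith
  have hdμ : d ≤ μ := (abs_le_of_sq_le_sq' hdM hμ).2
  have hμ_ge : 7 / 5 ≤ μ := by nlinarith
  have habs : |q - 2| ≤ μ ^ 2 := abs_le.mpr ⟨by linarith, by linarith⟩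
  have hcubic : 5 / 2 * μ ^ 2 + 3 * μ + 4 ≤ 8 * μ ^ 3 := by
    nlinarith [mul_nonneg hμ (sub_nonneg.mpr hμ_ge),
      mul_nonneg (sq_nonneg μ) (sub_nonneg.mpr hμ_ge)]
  calc μ ^ 2 * (d ^ 2 / 2 + 3 * d + 4 + 2 * |q - 2|) ≤ μ ^ 2 * (8 * μ ^ 3) := by
        gcongr
        linarith
    _ = 8 * (μ ^ 2) ^ (5 / 2 : ℝ) := by
        rw [rpow_five_halves (sq_nonneg μ), Real.sqrt_sq hμ]
        ring

end Coefficients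

namespace LewisVelocity

section Third

variable {ι : Type*} [Fintype ι] {P : Matrix ι ι ℝ} {q : ℝ} {y z ρ : ι → ℝ}

section Pointwise

variable {Y U : ℝ} (hq : 0 < q) (hV : LewisVelocity P q y z ρ) (hY : ∀ i, |y i| ≤ Y)
  (hU : ∀ i, |z i - ρ i| ≤ U)
include hq hV hY hU

theorem abs_weight_div_le (i : ι) : |ρ i / q| ≤ Y + U / 2 := by
  have hρ : ρ i / q = -(y i + (z i - ρ i) / 2) := by
    rw [div_eq_iff hq.ne']
    linarith [hV.two_mul_mul_eq hq.ne' i]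
  rw [hρ, abs_neg]
  refine (abs_add_le _ _).trans (add_le_add (hY i) ?_)
  rw [abs_div, abs_two]
  linarith [hU i]

theorem abs_velocity_le (i : ι) : |z i| ≤ q * Y + |q - 2| / 2 * U := by
  have hz : z i = -(q * y i) - (q - 2) / 2 * (z i - ρ i) := by
    linarith [hV.two_mul_mul_eq hq.ne' i]
  rw [hz]
  refine (abs_sub _ _).trans ?_
  rw [abs_neg, abs_mul, abs_mul, abs_of_pos hq, abs_div, abs_two]
  gcongr
  exacts [hY i, hU i]

end Pointwise

variable [DecidableEq ι]

/-- The third derivative of the barrier along a line, in terms of the velocities. -/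
def third (P : Matrix ι ι ℝ) (q : ℝ) (y z ρ : ι → ℝ) : ℝ :=
  ∑ i, P i i * (3 * ρ i * y i ^ 2 - 2 * y i ^ 3 + ρ i ^ 3 / q
    - 3 / 2 * ρ i * (z i - ρ i) ^ 2 - (z i - ρ i) ^ 3) + cubicForm P z

theorem third_eq_sum : third P q y z ρ =
    3 * ∑ i, P i i * (y i * ρ i * y i) - 2 * ∑ i, P i i * (y i * y i * y i)
      + ∑ i, P i i * (ρ i / q * ρ i * ρ i)
      - 3 / 2 * ∑ i, P i i * ((z i - ρ i) * ρ i * (z i - ρ i))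
      - ∑ i, P i i * ((z i - ρ i) * (z i - ρ i) * (z i - ρ i)) + cubicForm P z := by
  rw [third]
  congr 1
  simp only [Finset.mul_sum, ← Finset.sum_add_distrib, ← Finset.sum_sub_distrib]
  exact Finset.sum_congr rfl fun i _ => by ring

theorem abs_third_le_sqrt_second (hP : IsStarProjection P) (hq : 0 < q)
    (hV : LewisVelocity P q y z ρ) {Y U d : ℝ} (hY0 : 0 ≤ Y) (hU0 : 0 ≤ U)
    (hY : ∀ i, |y i| ≤ Y) (hU : ∀ i, |z i - ρ i| ≤ U) (hd0 : 0 ≤ d)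
    (hd : d ^ 2 = q ^ 2 / (q + 1)) :
    |third P q y z ρ| ≤ (Y * (3 * d + 2 + d ^ 2 + 4 * q) +
      U * (d ^ 2 / 2 + 3 * d + 4 + 2 * |q - 2|)) * √(second P y ρ) ^ 2 := by
  set S := √(second P y ρ)
  have hS0 : 0 ≤ S := Real.sqrt_nonneg _
  have hS : second P y ρ = S ^ 2 := (Real.sq_sqrt (hV.second_nonneg hP hq)).symm
  have hσ := starProjection_self_nonneg hP
  have hy2 : ∑ i, P i i * y i ^ 2 ≤ S ^ 2 := hS ▸ hV.sum_slack_sq_le hP hq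
  have hρ2 : ∑ i, P i i * ρ i ^ 2 ≤ (d * S) ^ 2 := by
    rw [mul_pow, hd, ← hS]
    exact hV.sum_weight_sq_le hP hq
  have hu2 : ∑ i, P i i * (z i - ρ i) ^ 2 ≤ (2 * S) ^ 2 :=
    (hV.sum_sub_sq_le hP hq).trans_eq (by rw [hS]; ring)
  have hdS : 0 ≤ d * S := by positivity
  have h2S : 0 ≤ 2 * S := by positivity
  have hyρy := abs_sum_mul_mul_mul_le hσ hY hY0 hdS hS0 hρ2 hy2
  have hyyy := abs_sum_mul_mul_mul_le hσ hY hY0 hS0 hS0 hy2 hy2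
  have hρρρ := abs_sum_mul_mul_mul_le hσ (hV.abs_weight_div_le hq hY hU) (by positivity) hdS hdS
    hρ2 hρ2
  have huρu := abs_sum_mul_mul_mul_le hσ hU hU0 hdS h2S hρ2 hu2
  have huuu := abs_sum_mul_mul_mul_le hσ hU hU0 h2S h2S hu2 hu2
  have hcubic : |cubicForm P z| ≤ (q * Y + |q - 2| / 2 * U) * (4 * S ^ 2) :=
    (abs_cubicForm_le hP (hV.abs_velocity_le hq hY hU)).trans
      (mul_le_mul_of_nonneg_left (hS ▸ hV.dotProduct_hadamard_mulVec_le hP hq) (by positivity))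
  rw [third_eq_sum]
  rw [abs_le] at hyρy hyyy hρρρ huρu huuu hcubic ⊢
  constructor <;> linarith

theorem abs_third_le (hP : IsStarProjection P) (hP0 : ∀ i, 0 < P i i) (hq : 0 < q)
    (hV : LewisVelocity P q y z ρ) {κ : ℝ} (hκ : 0 ≤ κ)
    (hy : ∀ i, |y i| ≤ κ * √(∑ j, P j j * y j ^ 2)) :
    |third P q y z ρ| ≤
      2 * ((q + 2) ^ (3 / 2 : ℝ) * κ + 4 * max q 2 ^ (5 / 2 : ℝ)) * √(second P y ρ) ^ 3 := by
  have hd : (q / √(q + 1)) ^ 2 = q ^ 2 / (q + 1) := by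
    rw [div_pow, Real.sq_sqrt (by linarith)]
  have hY : ∀ i, |y i| ≤ κ * √(second P y ρ) := fun i => (hy i).trans
    (mul_le_mul_of_nonneg_left (Real.sqrt_le_sqrt (hV.sum_slack_sq_le hP hq)) hκ)
  refine (hV.abs_third_le_sqrt_second hP hq (by positivity) (by positivity) hY
    (hV.abs_sub_le_mul_sqrt_second hP hq hP0) (by positivity) hd).trans ?_
  have hslack := concordance_coeff_slack_le hq hd
  have hmax := concordance_coeff_max_le hq hd
  set d := q / √(q + 1)
  set S := √(second P y ρ)
  calc _ = (κ * (3 * d + 2 + d ^ 2 + 4 * q) +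
        max q 2 * (d ^ 2 / 2 + 3 * d + 4 + 2 * |q - 2|)) * S ^ 3 := by ring
    _ ≤ (κ * (2 * (q + 2) ^ (3 / 2 : ℝ)) + 8 * max q 2 ^ (5 / 2 : ℝ)) * S ^ 3 := by gcongr
    _ = _ := by ring

end Third

end LewisVelocity

section LeverageScores

variable {ι κ : Type*} [Fintype ι] [DecidableEq ι] [Fintype κ] {A : Matrix ι κ ℝ}

/-- The Gram matrix `Aᵀ diag(e^l) A`. Positive weights are parametrized by their logarithms `l`. -/
def expGram (A : Matrix ι κ ℝ) (l : ι → ℝ) : Matrix κ κ ℝ :=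
  Aᵀ * Matrix.diagonal (fun i => Real.exp (l i)) * A

theorem expGram_posDef (hA : Function.Injective A.mulVec) (l : ι → ℝ) :
    (expGram A l).PosDef := by
  have hgram := (Matrix.PosDef.diagonal (d := fun i => Real.exp (l i))
    (fun i => Real.exp_pos _)).conjTranspose_mul_mul_same hA
  rwa [Matrix.conjTranspose_eq_transpose_of_trivial] at hgram

variable [DecidableEq κ]

/-- The matrix `A (Aᵀ diag(e^l) A)⁻¹ Aᵀ`. -/
def hat (A : Matrix ι κ ℝ) (l : ι → ℝ) : Matrix ι ι ℝ :=
  A * (expGram A l)⁻¹ * Aᵀ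

/-- The orthogonal projection onto the range of `diag(e^(l/2)) A`. -/
def levProj (A : Matrix ι κ ℝ) (l : ι → ℝ) : Matrix ι ι ℝ :=
  Matrix.diagonal (fun i => Real.exp (l i / 2)) * hat A l *
    Matrix.diagonal fun i => Real.exp (l i / 2)

/-- The leverage scores of the rows of `diag(e^(l/2)) A`. -/
def lev (A : Matrix ι κ ℝ) (l : ι → ℝ) (i : ι) : ℝ :=
  levProj A l i i

/-- `log det (Aᵀ diag(e^l) A)`. -/
def logDet (A : Matrix ι κ ℝ) (l : ι → ℝ) : ℝ :=
  Real.log (expGram A l).det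

theorem levProj_apply (A : Matrix ι κ ℝ) (l : ι → ℝ) (i j : ι) :
    levProj A l i j = Real.exp (l i / 2) * hat A l i j * Real.exp (l j / 2) := by
  rw [levProj, Matrix.mul_diagonal, Matrix.diagonal_mul]

theorem lev_eq_exp_mul (A : Matrix ι κ ℝ) (l : ι → ℝ) (i : ι) :
    lev A l i = Real.exp (l i) * hat A l i i := by
  rw [lev, levProj_apply, mul_right_comm, ← Real.exp_add, add_halves]

theorem isUnit_det_expGram (hA : Function.Injective A.mulVec) (l : ι → ℝ) :
    IsUnit (expGram A l).det :=
  (expGram_posDef hA l).det_pos.ne'.isUnit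

theorem transpose_hat (hA : Function.Injective A.mulVec) (l : ι → ℝ) :
    (hat A l)ᵀ = hat A l := by
  have hinv : (expGram A l)⁻¹ᵀ = (expGram A l)⁻¹ := by
    have hherm := (expGram_posDef hA l).inv.isHermitian.eq
    rwa [Matrix.conjTranspose_eq_transpose_of_trivial] at hherm
  rw [hat, Matrix.transpose_mul, Matrix.transpose_mul, hinv, Matrix.transpose_transpose,
    Matrix.mul_assoc]

theorem hat_apply_comm (hA : Function.Injective A.mulVec) (l : ι → ℝ) (i j : ι) :
    hat A l i j = hat A l j i :=
  congrFun (congrFun (transpose_hat hA l).symm i) j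

theorem hat_mul_diagonal_mul (hA : Function.Injective A.mulVec) (l : ι → ℝ) :
    hat A l * Matrix.diagonal (fun i => Real.exp (l i)) * A = A := by
  calc hat A l * Matrix.diagonal (fun i => Real.exp (l i)) * A
      = A * ((expGram A l)⁻¹ * expGram A l) := by simp only [hat, expGram, Matrix.mul_assoc]
    _ = A := by rw [Matrix.nonsing_inv_mul _ (isUnit_det_expGram hA l), Matrix.mul_one]

theorem hat_mul_diagonal_mul_hat (hA : Function.Injective A.mulVec) (l : ι → ℝ) :
    hat A l * Matrix.diagonal (fun i => Real.exp (l i)) * hat A l = hat A l := by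
  calc hat A l * Matrix.diagonal (fun i => Real.exp (l i)) * hat A l
      = hat A l * Matrix.diagonal (fun i => Real.exp (l i)) * A * ((expGram A l)⁻¹ * Aᵀ) := by
        rw [Matrix.mul_assoc _ A, ← Matrix.mul_assoc A, ← hat]
    _ = hat A l := by rw [hat_mul_diagonal_mul hA, ← Matrix.mul_assoc, ← hat]

theorem diagonal_exp_half_mul_self (l : ι → ℝ) :
    Matrix.diagonal (fun i => Real.exp (l i / 2)) * Matrix.diagonal (fun i => Real.exp (l i / 2)) =
      Matrix.diagonal fun i => Real.exp (l i) := by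
  simp only [Matrix.diagonal_mul_diagonal, ← Real.exp_add, add_halves]

theorem isStarProjection_levProj (hA : Function.Injective A.mulVec) (l : ι → ℝ) :
    IsStarProjection (levProj A l) where
  isIdempotentElem := by
    rw [IsIdempotentElem]
    conv_rhs => rw [levProj, ← hat_mul_diagonal_mul_hat hA, ← diagonal_exp_half_mul_self l]
    simp only [levProj, Matrix.mul_assoc]
  isSelfAdjoint := by
    rw [IsSelfAdjoint, Matrix.star_eq_conjTranspose, Matrix.conjTranspose_eq_transpose_of_trivial,
      levProj, Matrix.transpose_mul, Matrix.transpose_mul, Matrix.diagonal_transpose,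
      transpose_hat hA, Matrix.mul_assoc]

theorem levProj_mulVec_exp_half_mul (hA : Function.Injective A.mulVec) (l : ι → ℝ) (h : κ → ℝ) :
    levProj A l *ᵥ (fun i => Real.exp (l i / 2) * (A *ᵥ h) i) =
      fun i => Real.exp (l i / 2) * (A *ᵥ h) i := by
  have hdiag : (fun i => Real.exp (l i / 2) * (A *ᵥ h) i) =
      Matrix.diagonal (fun i => Real.exp (l i / 2)) *ᵥ A *ᵥ h :=
    funext fun i => by rw [Matrix.mulVec_diagonal]
  rw [hdiag, Matrix.mulVec_mulVec, Matrix.mulVec_mulVec]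
  conv_rhs => rw [← hat_mul_diagonal_mul hA l, ← diagonal_exp_half_mul_self l]
  simp only [levProj, Matrix.mulVec_mulVec, Matrix.mul_assoc]

theorem exp_mul_mulVec_sq_le (hA : Function.Injective A.mulVec) (l : ι → ℝ) (h : κ → ℝ) (i : ι) :
    Real.exp (l i) * (A *ᵥ h) i ^ 2 ≤ lev A l i * ∑ j, Real.exp (l j) * (A *ᵥ h) j ^ 2 := by
  have hsq : ∀ j, (Real.exp (l j / 2) * (A *ᵥ h) j) ^ 2 = Real.exp (l j) * (A *ᵥ h) j ^ 2 :=
    fun j => by rw [mul_pow, ← Real.exp_nat_mul, Nat.cast_ofNat, mul_div_cancel₀ _ two_ne_zero]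
  have hle := starProjection_mulVec_sq_le (isStarProjection_levProj hA l)
    (fun j => Real.exp (l j / 2) * (A *ᵥ h) j) i
  rw [levProj_mulVec_exp_half_mul hA] at hle
  simpa only [dotProduct, ← sq, hsq, lev] using hle

theorem mulVec_sq_le (hA : Function.Injective A.mulVec) (l : ι → ℝ) (h : κ → ℝ) (i : ι) :
    (A *ᵥ h) i ^ 2 ≤ hat A l i i * ∑ j, Real.exp (l j) * (A *ᵥ h) j ^ 2 := by
  have hle := exp_mul_mulVec_sq_le hA l h i
  rw [lev_eq_exp_mul, mul_assoc] at hle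
  exact le_of_mul_le_mul_left hle (Real.exp_pos _)

theorem hat_self_eq_dotProduct (A : Matrix ι κ ℝ) (l : ι → ℝ) (i : ι) :
    hat A l i i = A i ⬝ᵥ (expGram A l)⁻¹ *ᵥ A i := by
  rw [Matrix.dotProduct_mulVec]
  rfl

theorem hat_self_pos (hA : Function.Injective A.mulVec) (hA0 : ∀ i, A i ≠ 0) (l : ι → ℝ) (i : ι) :
    0 < hat A l i i := by
  rw [hat_self_eq_dotProduct]
  exact (expGram_posDef hA l).inv.dotProduct_mulVec_pos (hA0 i)

theorem lev_pos (hA : Function.Injective A.mulVec) (hA0 : ∀ i, A i ≠ 0) (l : ι → ℝ) (i : ι) :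
    0 < lev A l i := by
  rw [lev_eq_exp_mul]
  exact mul_pos (Real.exp_pos _) (hat_self_pos hA hA0 l i)

theorem sum_exp_mul_hat_sq (hA : Function.Injective A.mulVec) (l : ι → ℝ) (i : ι) :
    ∑ j, Real.exp (l j) * hat A l j i ^ 2 = hat A l i i := by
  conv_rhs => rw [← hat_mul_diagonal_mul_hat hA l, Matrix.mul_apply]
  refine Finset.sum_congr rfl fun j _ => ?_
  rw [Matrix.mul_diagonal, hat_apply_comm hA l i j]
  ring

theorem hat_self_le_mul_hat_self (hA : Function.Injective A.mulVec) (hA0 : ∀ i, A i ≠ 0)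
    {l l' : ι → ℝ} {k : ℝ} (hk : ∀ i, Real.exp (l i) ≤ k * Real.exp (l' i)) (i : ι) :
    hat A l' i i ≤ k * hat A l i i := by
  have hcol : A *ᵥ ((expGram A l')⁻¹ *ᵥ A i) = fun j => hat A l' j i := by
    rw [Matrix.mulVec_mulVec]
    rfl
  have hle := mulVec_sq_le hA l ((expGram A l')⁻¹ *ᵥ A i) i
  rw [hcol] at hle
  have hsum : ∑ j, Real.exp (l j) * hat A l' j i ^ 2 ≤ k * hat A l' i i := by
    rw [← sum_exp_mul_hat_sq hA l', Finset.mul_sum]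
    refine Finset.sum_le_sum fun j _ => ?_
    rw [← mul_assoc]
    exact mul_le_mul_of_nonneg_right (hk j) (sq_nonneg _)
  refine le_of_mul_le_mul_right ?_ (hat_self_pos hA hA0 l' i)
  calc hat A l' i i * hat A l' i i = hat A l' i i ^ 2 := (sq _).symm
    _ ≤ hat A l i i * (k * hat A l' i i) :=
        hle.trans (mul_le_mul_of_nonneg_left hsum (hat_self_pos hA hA0 l i).le)
    _ = k * hat A l i i * hat A l' i i := by ring

theorem sum_mul_hat_self (A : Matrix ι κ ℝ) (l c : ι → ℝ) :
    ∑ i, c i * hat A l i i = ((expGram A l)⁻¹ * (Aᵀ * Matrix.diagonal c * A)).trace := by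
  rw [Matrix.mul_assoc Aᵀ, ← Matrix.mul_assoc, Matrix.trace_mul_comm, Matrix.mul_assoc,
    ← Matrix.mul_assoc A]
  simp only [Matrix.trace, Matrix.diag_apply, Matrix.diagonal_mul, hat]

theorem sum_lev (hA : Function.Injective A.mulVec) (l : ι → ℝ) :
    ∑ i, lev A l i = Fintype.card κ := by
  simp only [lev_eq_exp_mul, sum_mul_hat_self]
  rw [← expGram, Matrix.nonsing_inv_mul _ (isUnit_det_expGram hA l), Matrix.trace_one]

end LeverageScores

section LogDet

variable {ι κ : Type*} [Fintype ι] [DecidableEq ι] [Fintype κ] [DecidableEq κ]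

theorem log_det_le_trace_sub_card {M : Matrix κ κ ℝ} (hM : M.PosDef) :
    Real.log M.det ≤ M.trace - Fintype.card κ := by
  rw [hM.isHermitian.det_eq_prod_eigenvalues, hM.isHermitian.trace_eq_sum_eigenvalues]
  simp only [RCLike.ofReal_real_eq_id, id]
  rw [Real.log_prod fun i _ => (hM.eigenvalues_pos i).ne']
  calc ∑ i, Real.log (hM.isHermitian.eigenvalues i)
      ≤ ∑ i, (hM.isHermitian.eigenvalues i - 1) :=
        Finset.sum_le_sum fun i _ => Real.log_le_sub_one_of_pos (hM.eigenvalues_pos i)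
    _ = _ := by rw [Finset.sum_sub_distrib, Finset.sum_const, Finset.card_univ, nsmul_one]

theorem log_det_le_add_trace_inv_mul {G N : Matrix κ κ ℝ} (hG : G.PosDef) (hN : N.PosDef) :
    Real.log N.det ≤ Real.log G.det + (G⁻¹ * N).trace - Fintype.card κ := by
  obtain ⟨B, hB⟩ : ∃ B : Matrix κ κ ℝ, G⁻¹ = Bᵀ * B := by
    open scoped MatrixOrder in
    obtain ⟨B, hB⟩ := CStarAlgebra.nonneg_iff_eq_star_mul_self.mp hG.inv.posSemidef.nonneg
    exact ⟨B, hB.trans (congrArg (· * B) (Matrix.conjTranspose_eq_transpose_of_trivial B))⟩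
  have hdet : B.det * B.det * G.det = 1 := by
    rw [← Matrix.det_one (n := κ), ← Matrix.nonsing_inv_mul G hG.det_pos.ne'.isUnit, hB,
      Matrix.det_mul, Matrix.det_mul, Matrix.det_transpose]
  have hB0 : Bᵀ.det ≠ 0 := by
    rw [Matrix.det_transpose]
    rintro h
    simp [h] at hdet
  have hM : (B * N * Bᵀ).PosDef := by
    have hconj := hN.conjTranspose_mul_mul_same (Matrix.mulVec_injective_of_det_ne_zero hB0)
    rwa [Matrix.conjTranspose_eq_transpose_of_trivial, Matrix.transpose_transpose] at hconj
  have htrace : (B * N * Bᵀ).trace = (G⁻¹ * N).trace := by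
    rw [Matrix.trace_mul_comm, ← Matrix.mul_assoc, hB]
  have hdetM : (B * N * Bᵀ).det = N.det / G.det := by
    rw [Matrix.det_mul, Matrix.det_mul, Matrix.det_transpose, eq_div_iff hG.det_pos.ne']
    linear_combination N.det * hdet
  have hle := log_det_le_trace_sub_card hM
  rw [hdetM, htrace, Real.log_div hN.det_pos.ne' hG.det_pos.ne'] at hle
  linarith

theorem log_det_gram_le {A : Matrix ι κ ℝ} (hA : Function.Injective A.mulVec) (l : ι → ℝ)
    {c : ι → ℝ} (hc : ∀ i, 0 ≤ c i) (hdet : 0 < (Aᵀ * Matrix.diagonal c * A).det) :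
    Real.log (Aᵀ * Matrix.diagonal c * A).det ≤
      logDet A l + ∑ i, c i * hat A l i i - Fintype.card κ := by
  have hsemi := (Matrix.PosSemidef.diagonal (d := c) hc).conjTranspose_mul_mul_same A
  rw [Matrix.conjTranspose_eq_transpose_of_trivial] at hsemi
  have hdef := hsemi.posDef_iff_isUnit.mpr ((Matrix.isUnit_iff_isUnit_det _).mpr hdet.ne'.isUnit)
  rw [sum_mul_hat_self]
  exact log_det_le_add_trace_inv_mul (expGram_posDef hA l) hdef

theorem logDet_le {A : Matrix ι κ ℝ} (hA : Function.Injective A.mulVec) (l l' : ι → ℝ) :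
    logDet A l' ≤ logDet A l + ∑ i, Real.exp (l' i) * hat A l i i - Fintype.card κ :=
  log_det_gram_le hA l (fun _ => (Real.exp_pos _).le) (expGram_posDef hA l').det_pos

end LogDet

section ContDiffMatrix

variable {𝕜 E κ : Type*} [NontriviallyNormedField 𝕜] [NormedAddCommGroup E] [NormedSpace 𝕜 E]
  [Fintype κ] [DecidableEq κ] {k : WithTop ℕ∞} {M : E → Matrix κ κ 𝕜}

theorem contDiff_matrix_det (hM : ∀ i j, ContDiff 𝕜 k fun x => M x i j) :
    ContDiff 𝕜 k fun x => (M x).det := by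
  simp only [Matrix.det_apply]
  exact ContDiff.sum fun σ _ => (contDiff_prod fun i _ => hM _ _).const_smul _

theorem contDiff_matrix_inv_apply (hM : ∀ i j, ContDiff 𝕜 k fun x => M x i j)
    (hdet : ∀ x, (M x).det ≠ 0) (i j : κ) : ContDiff 𝕜 k fun x => (M x)⁻¹ i j := by
  have hcramer : (fun x => (M x)⁻¹ i j) =
      fun x => (M x).det⁻¹ * ((M x).updateRow j (Pi.single i 1)).det := by
    funext x
    rw [Matrix.inv_def, Ring.inverse_eq_inv', Matrix.smul_apply, Matrix.adjugate_apply, smul_eq_mul]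
  rw [hcramer]
  refine ((contDiff_matrix_det hM).inv hdet).mul (contDiff_matrix_det fun a c => ?_)
  by_cases hac : a = j
  · subst hac
    simp only [Matrix.updateRow_self]
    exact contDiff_const
  · simp only [Matrix.updateRow_ne hac]
    exact hM a c

end ContDiffMatrix

section Calculus

variable {ι κ : Type*} [Fintype ι] [DecidableEq ι] {A : Matrix ι κ ℝ}

theorem contDiff_expGram_apply {k : WithTop ℕ∞} (i j : κ) :
    ContDiff ℝ k fun l => expGram A l i j := by
  simp only [expGram, Matrix.mul_apply (N := A), Matrix.mul_diagonal]
  fun_prop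

variable [Fintype κ] [DecidableEq κ]

theorem contDiff_hat_apply (hA : Function.Injective A.mulVec) {k : WithTop ℕ∞} (i j : ι) :
    ContDiff ℝ k fun l => hat A l i j := by
  have hinv := contDiff_matrix_inv_apply (k := k) (M := expGram A) contDiff_expGram_apply
    fun l => (expGram_posDef hA l).det_pos.ne'
  simp only [hat, Matrix.mul_apply]
  exact ContDiff.sum fun a _ =>
    (ContDiff.sum fun c _ => contDiff_const.mul (hinv c a)).mul contDiff_const

theorem contDiff_lev (hA : Function.Injective A.mulVec) {k : WithTop ℕ∞} (i : ι) :
    ContDiff ℝ k fun l => lev A l i := by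
  have hhat := contDiff_hat_apply hA (k := k) i i
  simp only [lev_eq_exp_mul]
  fun_prop

theorem contDiff_logDet (hA : Function.Injective A.mulVec) {k : WithTop ℕ∞} :
    ContDiff ℝ k (logDet A) :=
  (contDiff_matrix_det contDiff_expGram_apply).log fun l => (expGram_posDef hA l).det_pos.ne'

/-- The resolvent identity, from which the derivative of `hat` can be read off. -/
theorem hat_eq_sub (hA : Function.Injective A.mulVec) (l l' : ι → ℝ) :
    hat A l' = hat A l -
      hat A l * Matrix.diagonal (fun i => Real.exp (l' i) - Real.exp (l i)) * hat A l' := by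
  have htranspose := congrArg Matrix.transpose (hat_mul_diagonal_mul hA l')
  rw [Matrix.transpose_mul, Matrix.transpose_mul, transpose_hat hA, Matrix.diagonal_transpose]
    at htranspose
  have hl' : hat A l * Matrix.diagonal (fun i => Real.exp (l' i)) * hat A l' = hat A l := by
    calc hat A l * Matrix.diagonal (fun i => Real.exp (l' i)) * hat A l'
        = A * (expGram A l)⁻¹ *
            (Aᵀ * (Matrix.diagonal (fun i => Real.exp (l' i)) * hat A l')) := by
          simp only [hat, Matrix.mul_assoc]
      _ = hat A l := by rw [htranspose, ← hat]
  have hl : hat A l * Matrix.diagonal (fun i => Real.exp (l i)) * hat A l' = hat A l' := by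
    calc hat A l * Matrix.diagonal (fun i => Real.exp (l i)) * hat A l'
        = (hat A l * Matrix.diagonal (fun i => Real.exp (l i)) * A) * ((expGram A l')⁻¹ * Aᵀ) := by
          simp only [hat, Matrix.mul_assoc]
      _ = hat A l' := by rw [hat_mul_diagonal_mul hA, ← Matrix.mul_assoc, ← hat]
  rw [← Matrix.diagonal_sub, Matrix.mul_sub, Matrix.sub_mul, hl', hl, sub_sub_cancel]

section Curve

variable {l : ℝ → ι → ℝ} {z : ι → ℝ} {t : ℝ}

theorem hasDerivAt_hat (hA : Function.Injective A.mulVec) (hl : HasDerivAt l z t) (i j : ι) :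
    HasDerivAt (fun r => hat A (l r) i j)
      (-(hat A (l t) * Matrix.diagonal (fun k => Real.exp (l t k) * z k) * hat A (l t)) i j) t := by
  have hdiff : ∀ k, DifferentiableAt ℝ (fun r => hat A (l r) k j) t := fun k =>
    ((contDiff_hat_apply hA (k := 1) k j).differentiable one_ne_zero (l t)).comp t
      hl.differentiableAt
  have hresolvent : (fun r => hat A (l r) i j) = fun r => hat A (l t) i j -
      ∑ k, hat A (l t) i k * (Real.exp (l r k) - Real.exp (l t k)) * hat A (l r) k j := by
    funext r
    conv_lhs => rw [hat_eq_sub hA (l t) (l r)]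
    simp only [Matrix.sub_apply, Matrix.mul_apply (N := hat A (l r)), Matrix.mul_diagonal]
  rw [hresolvent]
  have hsum := (HasDerivAt.fun_sum (u := Finset.univ) fun k _ =>
    ((((hasDerivAt_pi.mp hl k).exp.sub_const (Real.exp (l t k))).const_mul (hat A (l t) i k)).mul
      (hdiff k).hasDerivAt)).const_sub (hat A (l t) i j)
  refine hsum.congr_deriv (congrArg Neg.neg ?_)
  simp only [sub_self, mul_zero, zero_mul, add_zero, Matrix.mul_apply (N := hat A (l t)),
    Matrix.mul_diagonal]

theorem compression_levProj_apply (A : Matrix ι κ ℝ) (l z : ι → ℝ) (i j : ι) :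
    compression (levProj A l) z i j = Real.exp (l i / 2) *
      (hat A l * Matrix.diagonal (fun k => Real.exp (l k) * z k) * hat A l) i j *
      Real.exp (l j / 2) := by
  simp only [compression_apply, levProj_apply, Matrix.mul_apply (N := hat A l),
    Matrix.mul_diagonal, Finset.mul_sum, Finset.sum_mul]
  refine Finset.sum_congr rfl fun k _ => ?_
  conv_rhs => rw [← add_halves (l k), Real.exp_add]
  ring

theorem hasDerivAt_levProj (hA : Function.Injective A.mulVec) (hl : HasDerivAt l z t) (i j : ι) :
    HasDerivAt (fun r => levProj A (l r) i j)
      (levProj A (l t) i j * ((z i + z j) / 2) - compression (levProj A (l t)) z i j) t := by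
  have hexp : ∀ k, HasDerivAt (fun r => Real.exp (l r k / 2))
      (Real.exp (l t k / 2) * (z k / 2)) t := fun k =>
    ((hasDerivAt_pi.mp hl k).div_const 2).exp
  simp only [levProj_apply]
  refine (((hexp i).mul (hasDerivAt_hat hA hl i j)).mul (hexp j)).congr_deriv ?_
  rw [compression_levProj_apply]
  simp only [Pi.mul_apply]
  ring

theorem hasDerivAt_levProj_sq (hA : Function.Injective A.mulVec) (hl : HasDerivAt l z t)
    (i j : ι) :
    HasDerivAt (fun r => levProj A (l r) i j ^ 2) (levProj A (l t) i j ^ 2 * (z i + z j)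
      - 2 * (levProj A (l t) i j * compression (levProj A (l t)) z i j)) t := by
  refine ((hasDerivAt_levProj hA hl i j).fun_pow 2).congr_deriv ?_
  ring

theorem hasDerivAt_lev (hA : Function.Injective A.mulVec) (hl : HasDerivAt l z t) (i : ι) :
    HasDerivAt (fun r => lev A (l r) i)
      (lev A (l t) i * z i - ((levProj A (l t) ⊙ levProj A (l t)) *ᵥ z) i) t := by
  refine (hasDerivAt_levProj hA hl i i).congr_deriv ?_
  rw [add_self_div_two, ← lev, compression_apply, hadamard_self_mulVec_apply]
  congr 1
  refine Finset.sum_congr rfl fun j _ => ?_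
  rw [starProjection_apply_comm (isStarProjection_levProj hA _) j i]
  ring

theorem hasDerivAt_logDet (hA : Function.Injective A.mulVec) (hl : HasDerivAt l z t) :
    HasDerivAt (fun r => logDet A (l r)) (∑ i, lev A (l t) i * z i) t := by
  have hdiff : DifferentiableAt ℝ (fun r => logDet A (l r)) t :=
    ((contDiff_logDet hA (k := 1)).differentiable one_ne_zero (l t)).comp t hl.differentiableAt
  have hsum : HasDerivAt (fun r => ∑ i, Real.exp (l r i) * hat A (l t) i i)
      (∑ i, lev A (l t) i * z i) t := by
    refine (HasDerivAt.fun_sum fun i _ =>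
      (hasDerivAt_pi.mp hl i).exp.mul_const (hat A (l t) i i)).congr_deriv ?_
    exact Finset.sum_congr rfl fun k _ => by rw [lev_eq_exp_mul]; ring
  -- `logDet` touches its majorant `logDet_le` at `l t`, so both have the same derivative there.
  have hmin : IsLocalMin
      (fun r => (∑ i, Real.exp (l r i) * hat A (l t) i i) - logDet A (l r)) t := by
    refine Filter.Eventually.of_forall fun r => ?_
    have hle := logDet_le hA (l t) (l r)
    have hcard := sum_lev hA (l t)
    simp only [lev_eq_exp_mul] at hcard
    simp only [hcard]
    linarith
  exact hdiff.hasDerivAt.congr_deriv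
    (sub_eq_zero.mp (hmin.hasDerivAt_eq_zero (hsum.sub hdiff.hasDerivAt))).symm

end Curve

theorem le_logDet (hA : Function.Injective A.mulVec) (l l' : ι → ℝ) :
    logDet A l + ∑ i, lev A l i * (l' i - l i) ≤ logDet A l' := by
  set z := l' - l
  set c : ℝ → ι → ℝ := fun r => l + r • z with hc
  have hline : ∀ r, HasDerivAt c z r := fun r =>
    (((hasDerivAt_id r).smul_const z).const_add l).congr_deriv (one_smul ℝ z)
  have hfirst : ∀ r, HasDerivAt (fun r => logDet A (c r)) (∑ i, lev A (c r) i * z i) r :=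
    fun r => hasDerivAt_logDet hA (hline r)
  have hsecond : ∀ r, HasDerivAt (fun r => ∑ i, lev A (c r) i * z i)
      (∑ i, (lev A (c r) i * z i - ((levProj A (c r) ⊙ levProj A (c r)) *ᵥ z) i) * z i) r :=
    fun r => HasDerivAt.fun_sum fun i _ => (hasDerivAt_lev hA (hline r) i).mul_const _
  have hconv : ConvexOn ℝ Set.univ fun r => logDet A (c r) := by
    refine convexOn_of_hasDerivWithinAt2_nonneg convex_univ
      (fun r _ => (hfirst r).continuousAt.continuousWithinAt)
      (fun r _ => (hfirst r).hasDerivWithinAt) (fun r _ => (hsecond r).hasDerivWithinAt)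
      fun r _ => ?_
    have hle := dotProduct_hadamard_self_mulVec_le (isStarProjection_levProj hA (c r)) z
    rw [← sub_nonneg, dotProduct, ← Finset.sum_sub_distrib] at hle
    refine hle.trans_eq (Finset.sum_congr rfl fun i _ => ?_)
    rw [lev]
    ring
  have hslope := hconv.le_slope_of_hasDerivAt (Set.mem_univ 0) (Set.mem_univ 1) one_pos (hfirst 0)
  rw [slope_def_field, sub_zero, div_one] at hslope
  simp only [hc, zero_smul, add_zero, one_smul, z, add_sub_cancel] at hslope
  exact le_sub_iff_add_le'.mp hslope

end Calculus

section LewisMap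

variable {ι κ : Type*} [Fintype ι] [DecidableEq ι] [Fintype κ] [DecidableEq κ] {A : Matrix ι κ ℝ}
  {q : ℝ}

/-- The logarithmic derivative of the leverage scores in the direction `z`. -/
def levVelocity (A : Matrix ι κ ℝ) (l z : ι → ℝ) (i : ι) : ℝ :=
  z i - ((levProj A l ⊙ levProj A l) *ᵥ z) i / lev A l i

/-- The Lewis weights for the slacks `s` are the leverage scores of the point `l` with
`lewisMap A q l = -2 log s`. -/
def lewisMap (A : Matrix ι κ ℝ) (q : ℝ) (l : ι → ℝ) : ι → ℝ :=
  fun i => l i - (1 - 2 / q) * Real.log (lev A l i)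

section NonDegenerate

variable (hA : Function.Injective A.mulVec) (hA0 : ∀ i, A i ≠ 0)
include hA hA0

theorem lev_mul_levVelocity (l z : ι → ℝ) (i : ι) :
    lev A l i * levVelocity A l z i =
      lev A l i * z i - ((levProj A l ⊙ levProj A l) *ᵥ z) i := by
  rw [levVelocity, mul_sub, mul_div_cancel₀ _ (lev_pos hA hA0 l i).ne']

theorem lewisVelocity_levVelocity {l y z : ι → ℝ}
    (hz : ∀ i, z i = (1 - 2 / q) * levVelocity A l z i - 2 * y i) :
    LewisVelocity (levProj A l) q y z (levVelocity A l z) where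
  hadamard_mulVec i := by
    rw [← lev, mul_sub, lev_mul_levVelocity hA hA0, sub_sub_cancel]
  eq_sub := hz

theorem contDiff_lewisMap {k : WithTop ℕ∞} : ContDiff ℝ k (lewisMap A q) :=
  contDiff_pi.mpr fun i => (contDiff_apply ℝ ℝ i).sub
    (contDiff_const.mul ((contDiff_lev hA i).log fun l => (lev_pos hA hA0 l i).ne'))

theorem hasDerivAt_lewisMap {l : ℝ → ι → ℝ} {z : ι → ℝ} {t : ℝ} (hl : HasDerivAt l z t) (i : ι) :
    HasDerivAt (fun r => lewisMap A q (l r) i)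
      (z i - (1 - 2 / q) * levVelocity A (l t) z i) t := by
  have hlev := (lev_pos hA hA0 (l t) i).ne'
  refine ((hasDerivAt_pi.mp hl i).sub
    (((hasDerivAt_lev hA hl i).log hlev).const_mul _)).congr_deriv ?_
  rw [← lev_mul_levVelocity hA hA0, mul_div_cancel_left₀ _ hlev]

theorem fderiv_lewisMap_apply (l z : ι → ℝ) (i : ι) :
    fderiv ℝ (lewisMap A q) l z i = z i - (1 - 2 / q) * levVelocity A l z i := by
  have hline : HasDerivAt (fun r : ℝ => l + r • z) z 0 :=
    (((hasDerivAt_id (0 : ℝ)).smul_const z).const_add l).congr_deriv (one_smul ℝ z)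
  have hfderiv : HasFDerivAt (lewisMap A q) (fderiv ℝ (lewisMap A q) l) (l + (0 : ℝ) • z) := by
    rw [zero_smul, add_zero]
    exact ((contDiff_lewisMap hA hA0 (k := 1)).differentiable one_ne_zero l).hasFDerivAt
  have hcomp := hasDerivAt_pi.mp (hfderiv.comp_hasDerivAt (0 : ℝ) hline) i
  have hunique := hcomp.unique (hasDerivAt_lewisMap hA hA0 hline i)
  rwa [zero_smul, add_zero] at hunique

theorem fderiv_lewisMap_injective (hq : 0 < q) (l : ι → ℝ) :
    Function.Injective (fderiv ℝ (lewisMap A q) l) := by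
  rw [injective_iff_map_eq_zero]
  intro z hz
  have hV : LewisVelocity (levProj A l) q 0 z (levVelocity A l z) :=
    lewisVelocity_levVelocity hA hA0 fun i => by
      have hi := congrFun hz i
      rw [fderiv_lewisMap_apply hA hA0, Pi.zero_apply] at hi
      rw [Pi.zero_apply]
      linarith
  have hsum := hV.sum_sq_le (isStarProjection_levProj hA l) hq
  have hsecond : LewisVelocity.second (levProj A l) 0 (levVelocity A l z) = 0 :=
    Finset.sum_eq_zero fun i _ => by simp
  rw [hsecond, mul_zero] at hsum
  funext i
  have hterm : ∀ j ∈ Finset.univ, 0 ≤ lev A l j * z j ^ 2 := fun j _ =>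
    mul_nonneg (lev_pos hA hA0 l j).le (sq_nonneg (z j))
  have hi := (Finset.sum_eq_zero_iff_of_nonneg hterm).mp
    (le_antisymm hsum (Finset.sum_nonneg hterm)) i (Finset.mem_univ i)
  exact pow_eq_zero_iff two_ne_zero |>.mp
    ((mul_eq_zero.mp hi).resolve_left (lev_pos hA hA0 l i).ne')

/-- The derivative of `lewisMap` as an invertible map. -/
def lewisMapDeriv (hq : 0 < q) (l : ι → ℝ) : (ι → ℝ) ≃L[ℝ] (ι → ℝ) :=
  (LinearEquiv.ofInjectiveEndo (fderiv ℝ (lewisMap A q) l : (ι → ℝ) →ₗ[ℝ] (ι → ℝ))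
    (fderiv_lewisMap_injective hA hA0 hq l)).toContinuousLinearEquiv

theorem hasStrictFDerivAt_lewisMap (hq : 0 < q) (l : ι → ℝ) :
    HasStrictFDerivAt (lewisMap A q)
      (lewisMapDeriv hA hA0 hq l : (ι → ℝ) →L[ℝ] (ι → ℝ)) l :=
  (contDiff_lewisMap hA hA0 (k := 1)).contDiffAt.hasStrictFDerivAt one_ne_zero

theorem log_lev_nonpos (l : ι → ℝ) (i : ι) : Real.log (lev A l i) ≤ 0 :=
  Real.log_nonpos (lev_pos hA hA0 l i).le
    (starProjection_self_le_one (isStarProjection_levProj hA l) i)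

theorem exists_sub_le_log_lev :
    ∃ C : ℝ, ∀ l M, (∀ k, l k ≤ M) → ∀ i, l i - M - C ≤ Real.log (lev A l i) := by
  obtain ⟨C, hC⟩ := (Set.finite_range fun i => -Real.log (hat A 0 i i)).bddAbove
  refine ⟨C, fun l M hM i => ?_⟩
  have hpos := hat_self_pos hA hA0
  have hhat : hat A 0 i i ≤ Real.exp M * hat A l i i :=
    hat_self_le_mul_hat_self hA hA0 (fun k => by simpa using hM k) i
  have hlog := Real.log_le_log (hpos 0 i) hhat
  rw [Real.log_mul (Real.exp_pos _).ne' (hpos l i).ne', Real.log_exp] at hlog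
  rw [lev_eq_exp_mul, Real.log_mul (Real.exp_pos _).ne' (hpos l i).ne', Real.log_exp]
  linarith [hC ⟨i, rfl⟩]

theorem exists_abs_le_of_abs_lewisMap_le_of_two_le (hq : 2 ≤ q) (B : ℝ) :
    ∃ K : ℝ, ∀ l, (∀ i, |lewisMap A q l i| ≤ B) → ∀ i, |l i| ≤ K := by
  obtain ⟨C, hC⟩ := exists_sub_le_log_lev hA hA0
  have hp : 0 ≤ 1 - 2 / q := sub_nonneg.mpr ((div_le_one (by linarith)).mpr hq)
  have hp' : 0 < 2 / q := by positivity
  refine ⟨max B ((B + (1 - 2 / q) * (B + C)) / (2 / q)), fun l hl i => ?_⟩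
  have hle : ∀ j, l j ≤ B := fun j => by
    have hj := (abs_le.mp (hl j)).2
    rw [lewisMap] at hj
    linarith [mul_nonpos_of_nonneg_of_nonpos hp (log_lev_nonpos hA hA0 l j)]
  refine abs_le.mpr ⟨?_, (hle i).trans (le_max_left _ _)⟩
  refine neg_le.mp ((le_div_iff₀ hp').mpr ?_ |>.trans (le_max_right _ _))
  have hi := (abs_le.mp (hl i)).1
  rw [lewisMap] at hi
  linarith [mul_le_mul_of_nonneg_left (hC l B hle i) hp]

theorem exists_abs_le_of_abs_lewisMap_le_of_le_two (hq : 0 < q) (hq2 : q ≤ 2) (B : ℝ) :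
    ∃ K : ℝ, ∀ l, (∀ i, |lewisMap A q l i| ≤ B) → ∀ i, |l i| ≤ K := by
  obtain ⟨C, hC⟩ := exists_sub_le_log_lev hA hA0
  have hp : 1 - 2 / q ≤ 0 := sub_nonpos.mpr ((one_le_div hq).mpr hq2)
  refine ⟨max B (B - (1 - 2 / q) * C), fun l hl i => ?_⟩
  obtain ⟨k, -, hk⟩ := Finset.exists_max_image Finset.univ l ⟨i, Finset.mem_univ i⟩
  refine abs_le.mpr ⟨neg_le.mp (le_trans ?_ (le_max_left _ _)),
    (hk i (Finset.mem_univ i)).trans (le_trans ?_ (le_max_right _ _))⟩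
  · have hi := (abs_le.mp (hl i)).1
    rw [lewisMap] at hi
    linarith [mul_nonneg_of_nonpos_of_nonpos hp (log_lev_nonpos hA hA0 l i)]
  · have hlog := mul_le_mul_of_nonpos_left (hC l (l k) (fun j => hk j (Finset.mem_univ j)) k) hp
    have hkB := (abs_le.mp (hl k)).2
    rw [lewisMap] at hkB
    linarith

theorem isProperMap_lewisMap (hq : 0 < q) : IsProperMap (lewisMap A q) := by
  have hcont : Continuous (lewisMap A q) := (contDiff_lewisMap hA hA0 (k := 0)).continuous
  refine isProperMap_iff_isCompact_preimage.mpr ⟨hcont, fun K hK => ?_⟩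
  obtain ⟨B, hB⟩ := hK.isBounded.exists_norm_le
  obtain ⟨R, hR⟩ : ∃ R : ℝ, ∀ l, (∀ i, |lewisMap A q l i| ≤ B) → ∀ i, |l i| ≤ R :=
    (le_total 2 q).elim (exists_abs_le_of_abs_lewisMap_le_of_two_le hA hA0 · B)
      (exists_abs_le_of_abs_lewisMap_le_of_le_two hA hA0 hq · B)
  refine Metric.isCompact_of_isClosed_isBounded (hK.isClosed.preimage hcont)
    (isBounded_iff_forall_norm_le.mpr ⟨max R 0, fun l hl => ?_⟩)
  refine (pi_norm_le_iff_of_nonneg (le_max_right _ _)).mpr fun i => ?_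
  exact (hR l (fun j => (norm_le_pi_norm (lewisMap A q l) j).trans (hB _ hl)) i).trans
    (le_max_left _ _)

/-- `lewisMap` is open because its derivative is invertible, and closed because it is proper. -/
theorem lewisMap_surjective (hq : 0 < q) : Function.Surjective (lewisMap A q) := by
  have hopen : IsOpenMap (lewisMap A q) :=
    isOpenMap_of_hasStrictFDerivAt_equiv (hasStrictFDerivAt_lewisMap hA hA0 hq)
  have hclosed := (isProperMap_lewisMap hA hA0 hq).isClosedMap
  exact Set.range_eq_univ.mp
    (IsClopen.eq_univ ⟨hclosed.isClosed_range, hopen.isOpen_range⟩ (Set.range_nonempty _))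

theorem exists_local_inverse_lewisMap (hq : 0 < q) {k : WithTop ℕ∞} (hk : k ≠ 0)
    (l : ι → ℝ) :
    ∃ g : (ι → ℝ) → ι → ℝ, ContDiffAt ℝ k g (lewisMap A q l) ∧
      ∀ᶠ t in 𝓝 (lewisMap A q l), lewisMap A q (g t) = t := by
  have hcont : ContDiffAt ℝ k (lewisMap A q) l := (contDiff_lewisMap hA hA0).contDiffAt
  have hderiv := (hasStrictFDerivAt_lewisMap hA hA0 hq l).hasFDerivAt
  exact ⟨hcont.localInverse hderiv hk, hcont.to_localInverse hderiv hk,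
    (hcont.hasStrictFDerivAt' hderiv hk).eventually_right_inverse⟩

end NonDegenerate

end LewisMap

section LewisWeights

variable {m n : ℕ} {A : Matrix (Fin m) (Fin n) ℝ} {q : ℝ} {b : Fin m → ℝ} {x : Fin n → ℝ}
  {l w : Fin m → ℝ}

theorem NonDegenerate.injective (hA : NonDegenerate A) : Function.Injective A.mulVec := by
  have hker : Module.finrank ℝ (LinearMap.ker A.mulVecLin) = 0 := by
    have hrank : Module.finrank ℝ (LinearMap.range A.mulVecLin) = n := hA.1
    have hsum := LinearMap.finrank_range_add_finrank_ker A.mulVecLin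
    rw [hrank, Module.finrank_fin_fun] at hsum
    exact Nat.add_eq_left.mp hsum
  exact LinearMap.ker_eq_bot.mp (Submodule.finrank_eq_zero.mp hker)

theorem exp_mul_log_sub_two_mul_log {a s : ℝ} (ha : 0 < a) (hs : 0 < s) (p : ℝ) :
    Real.exp (p * Real.log a - 2 * Real.log s) = a ^ p * s⁻¹ ^ 2 := by
  rw [Real.exp_sub, Real.rpow_def_of_pos ha, mul_comm (Real.log a), two_mul (Real.log s),
    Real.exp_add, Real.exp_log hs, inv_pow, ← div_eq_mul_inv, sq]

theorem weightedGram_scaledMatrix (q : ℝ) (A : Matrix (Fin m) (Fin n) ℝ) (b : Fin m → ℝ)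
    (x : Fin n → ℝ) (w : Fin m → ℝ) :
    weightedGram q (scaledMatrix A b x) w =
      Aᵀ * Matrix.diagonal (fun i => w i ^ (1 - 2 / q) * ((A *ᵥ x) i - b i)⁻¹ ^ 2) * A := by
  have hassoc : ∀ D E : Matrix (Fin m) (Fin m) ℝ, Aᵀ * E * D * (E * A) = Aᵀ * (E * D * E) * A := by
    intro D E
    simp only [Matrix.mul_assoc]
  rw [weightedGram, scaledMatrix, Matrix.transpose_mul, Matrix.diagonal_transpose, hassoc,
    Matrix.diagonal_mul_diagonal, Matrix.diagonal_mul_diagonal]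
  congr 3
  funext i
  ring

theorem weightedGram_eq_expGram (hx : x ∈ interiorSet A b) (hw : ∀ i, 0 < w i) :
    weightedGram q (scaledMatrix A b x) w =
      expGram A fun i => (1 - 2 / q) * Real.log (w i) - 2 * Real.log ((A *ᵥ x) i - b i) := by
  simp only [weightedGram_scaledMatrix, expGram,
    exp_mul_log_sub_two_mul_log (hw _) (sub_pos.mpr (hx _))]

theorem potential_eq (hx : x ∈ interiorSet A b) (hw : ∀ i, 0 < w i) :
    potential q A b x w =
      logDet A (fun i => (1 - 2 / q) * Real.log (w i) - 2 * Real.log ((A *ᵥ x) i - b i)) -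
        (1 - 2 / q) * ∑ i, w i := by
  rw [potential, weightedGram_eq_expGram hx hw, logDet]

theorem mem_admissibleWeights (hA : Function.Injective A.mulVec) (hx : x ∈ interiorSet A b)
    (hw : ∀ i, 0 < w i) : w ∈ admissibleWeights q A b x :=
  ⟨fun i => (hw i).le, fun _ => hw,
    weightedGram_eq_expGram (q := q) hx hw ▸ (expGram_posDef hA _).det_pos⟩

/-- The point `l` solves the Lewis equation at `x`, so that `lev A l` are the Lewis weights of
`scaledMatrix A b x`. -/
def IsLewis (q : ℝ) (A : Matrix (Fin m) (Fin n) ℝ) (b : Fin m → ℝ) (x : Fin n → ℝ)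
    (l : Fin m → ℝ) : Prop :=
  ∀ i, lewisMap A q l i = -2 * Real.log ((A *ᵥ x) i - b i)

/-- The critical value of `f(x, ·) / 2` in terms of a solution `l` of the Lewis equation. -/
def lewisValue (q : ℝ) (A : Matrix (Fin m) (Fin n) ℝ) (l : Fin m → ℝ) : ℝ :=
  1 / 2 * (logDet A l - (1 - 2 / q) * n)

theorem exists_isLewis (hA : NonDegenerate A) (hq : 0 < q) (b : Fin m → ℝ) (x : Fin n → ℝ) :
    ∃ l, IsLewis q A b x l :=
  let ⟨l, hl⟩ := lewisMap_surjective hA.injective hA.2 hq fun i => -2 * Real.log ((A *ᵥ x) i - b i)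
  ⟨l, congrFun hl⟩

namespace IsLewis

variable (hA : NonDegenerate A) (hx : x ∈ interiorSet A b) (hl : IsLewis q A b x l)

include hl in
theorem apply_eq (i : Fin m) :
    l i = (1 - 2 / q) * Real.log (lev A l i) - 2 * Real.log ((A *ᵥ x) i - b i) := by
  have hi := hl i
  rw [lewisMap] at hi
  linarith

include hA hx hl

theorem potential_lev : potential q A b x (lev A l) = logDet A l - (1 - 2 / q) * n := by
  simp only [potential_eq hx (lev_pos hA.injective hA.2 l), ← hl.apply_eq, sum_lev hA.injective,
    Fintype.card_fin]

theorem lewisValue_mem : lewisValue q A l ∈ barrierValues q A b x :=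
  ⟨lev A l, mem_admissibleWeights hA.injective hx (lev_pos hA.injective hA.2 l),
    congrArg (1 / 2 * ·) (hl.potential_lev hA hx)⟩

theorem hat_self (i : Fin m) :
    hat A l i i = lev A l i ^ (2 / q) * ((A *ᵥ x) i - b i) ^ 2 := by
  have hs : 0 < (A *ᵥ x) i - b i := sub_pos.mpr (hx i)
  have hlev := lev_pos hA.injective hA.2 l i
  have hsplit : lev A l i ^ (1 - 2 / q) * lev A l i ^ (2 / q) = lev A l i := by
    rw [← Real.rpow_add hlev, sub_add_cancel, Real.rpow_one]
  have hexp : Real.exp (l i) = lev A l i ^ (1 - 2 / q) * ((A *ᵥ x) i - b i)⁻¹ ^ 2 := by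
    rw [← exp_mul_log_sub_two_mul_log hlev hs, ← hl.apply_eq]
  refine mul_left_cancel₀ (Real.exp_pos (l i)).ne' ?_
  calc Real.exp (l i) * hat A l i i
      = lev A l i ^ (1 - 2 / q) * lev A l i ^ (2 / q) *
          (((A *ᵥ x) i - b i)⁻¹ * ((A *ᵥ x) i - b i)) ^ 2 := by
        rw [← lev_eq_exp_mul, hsplit, inv_mul_cancel₀ hs.ne', one_pow, mul_one]
    _ = Real.exp (l i) * (lev A l i ^ (2 / q) * ((A *ᵥ x) i - b i) ^ 2) := by
        rw [hexp]
        ring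

theorem weight_mul_hat_le (hq : 2 ≤ q) {i : Fin m} (hw : 0 ≤ w i) :
    w i ^ (1 - 2 / q) * ((A *ᵥ x) i - b i)⁻¹ ^ 2 * hat A l i i ≤
      (1 - 2 / q) * w i + 2 / q * lev A l i := by
  have hp : 0 ≤ 1 - 2 / q := sub_nonneg.mpr ((div_le_one (by linarith)).mpr hq)
  refine le_trans (le_of_eq ?_) (Real.geom_mean_le_arith_mean2_weighted hp (by positivity) hw
    (lev_pos hA.injective hA.2 l i).le (sub_add_cancel _ _))
  calc w i ^ (1 - 2 / q) * ((A *ᵥ x) i - b i)⁻¹ ^ 2 * hat A l i i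
      = w i ^ (1 - 2 / q) * lev A l i ^ (2 / q) *
          (((A *ᵥ x) i - b i)⁻¹ * ((A *ᵥ x) i - b i)) ^ 2 := by
        rw [hl.hat_self hA hx i]
        ring
    _ = w i ^ (1 - 2 / q) * lev A l i ^ (2 / q) := by
        rw [inv_mul_cancel₀ (sub_pos.mpr (hx i)).ne', one_pow, mul_one]

theorem isGreatest (hq : 2 ≤ q) : IsGreatest (barrierValues q A b x) (lewisValue q A l) := by
  refine ⟨hl.lewisValue_mem hA hx, ?_⟩
  rintro _ ⟨w, ⟨hw0, -, hdet⟩, rfl⟩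
  refine mul_le_mul_of_nonneg_left ?_ (by norm_num)
  rw [potential]
  rw [weightedGram_scaledMatrix] at hdet ⊢
  have hlog := log_det_gram_le hA.injective l
    (fun i => mul_nonneg (Real.rpow_nonneg (hw0 i) _) (sq_nonneg _)) hdet
  have hsum := Finset.sum_le_sum fun i (_ : i ∈ Finset.univ) =>
    hl.weight_mul_hat_le hA hx hq (hw0 i)
  rw [Finset.sum_add_distrib, ← Finset.mul_sum, ← Finset.mul_sum, sum_lev hA.injective] at hsum
  rw [Fintype.card_fin] at hlog hsum
  linarith

omit hx in
theorem mul_sub_lev_le (hq : 0 < q) (hq2 : q ≤ 2) {i : Fin m} (hw : 0 < w i) :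
    (1 - 2 / q) * (w i - lev A l i) ≤ lev A l i *
      ((1 - 2 / q) * Real.log (w i) - 2 * Real.log ((A *ᵥ x) i - b i) - l i) := by
  have hlev := lev_pos hA.injective hA.2 l i
  have hp : 1 - 2 / q ≤ 0 := sub_nonpos.mpr ((one_le_div hq).mpr hq2)
  have hlog := mul_le_mul_of_nonneg_left (Real.log_le_sub_one_of_pos (div_pos hw hlev)) hlev.le
  rw [Real.log_div hw.ne' hlev.ne', mul_sub_one, mul_div_cancel₀ _ hlev.ne'] at hlog
  calc (1 - 2 / q) * (w i - lev A l i)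
      ≤ (1 - 2 / q) * (lev A l i * (Real.log (w i) - Real.log (lev A l i))) :=
        mul_le_mul_of_nonpos_left hlog hp
    _ = lev A l i * ((1 - 2 / q) * Real.log (w i) - 2 * Real.log ((A *ᵥ x) i - b i) - l i) := by
        rw [hl.apply_eq i]
        ring

theorem isLeast_of_lt (hq : 0 < q) (hq2 : q < 2) :
    IsLeast (barrierValues q A b x) (lewisValue q A l) := by
  refine ⟨hl.lewisValue_mem hA hx, ?_⟩
  rintro _ ⟨w, ⟨-, hw, -⟩, rfl⟩
  refine mul_le_mul_of_nonneg_left ?_ (by norm_num)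
  rw [potential_eq hx (hw hq2)]
  have htangent := le_logDet hA.injective l
    fun i => (1 - 2 / q) * Real.log (w i) - 2 * Real.log ((A *ᵥ x) i - b i)
  have hsum := Finset.sum_le_sum fun i (_ : i ∈ Finset.univ) =>
    hl.mul_sub_lev_le hA hq hq2.le (hw hq2 i)
  rw [← Finset.mul_sum, Finset.sum_sub_distrib, sum_lev hA.injective, Fintype.card_fin] at hsum
  linarith

theorem isLeast (hq : 0 < q) (hq2 : q ≤ 2) :
    IsLeast (barrierValues q A b x) (lewisValue q A l) := by
  rcases hq2.eq_or_lt with rfl | hlt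
  · refine ⟨hl.lewisValue_mem hA hx, ?_⟩
    have hpotential := hl.potential_lev hA hx
    rintro _ ⟨w, -, rfl⟩
    simp only [potential, weightedGram, div_self (two_ne_zero' ℝ), sub_self, Real.rpow_zero,
      zero_mul, sub_zero] at hpotential
    simp only [lewisValue, potential, weightedGram, div_self (two_ne_zero' ℝ), sub_self,
      Real.rpow_zero, zero_mul, sub_zero, hpotential, le_refl]
  · exact hl.isLeast_of_lt hA hx hq hlt

theorem barrier_eq (hq : 0 < q) : barrier q A b x = lewisValue q A l := by
  rw [barrier]
  split_ifs with h
  · exact (hl.isGreatest hA hx h).csSup_eq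
  · exact (hl.isLeast hA hx hq (not_le.mp h).le).csInf_eq

end IsLewis

end LewisWeights

section LewisCurve

namespace LewisVelocity

variable {ι : Type*} [Fintype ι] [DecidableEq ι] {P : Matrix ι ι ℝ} {q : ℝ}
  {y z ρ z' ρ' : ι → ℝ}

omit [DecidableEq ι] in
theorem second_eq_sub_dotProduct (hV : LewisVelocity P q y z ρ) :
    second P y ρ = 1 / 2 * (∑ i, P i i * (z i ^ 2 + 2 * y i ^ 2 - (1 - 2 / q) * ρ i ^ 2) -
      z ⬝ᵥ (P ⊙ P) *ᵥ z) := by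
  rw [second, hV.dotProduct_hadamard_mulVec, ← Finset.sum_sub_distrib, Finset.mul_sum]
  refine Finset.sum_congr rfl fun i _ => ?_
  linear_combination -(1 / 2 * P i i * ρ i) * hV.eq_sub i

/-- The third derivative does not involve the accelerations `z'` and `ρ'`: they enter the
derivative of the second one only through `z' - (1 - 2/q) ρ'`. -/
theorem third_eq (hV : LewisVelocity P q y z ρ)
    (hz' : ∀ i, z' i = (1 - 2 / q) * ρ' i + 2 * y i ^ 2) :
    third P q y z ρ = 1 / 2 * (∑ i, (P i i * ρ i * (z i ^ 2 + 2 * y i ^ 2 - (1 - 2 / q) * ρ i ^ 2) +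
        P i i * (2 * (z i * z' i) - 4 * y i ^ 3 - 2 * (1 - 2 / q) * (ρ i * ρ' i))) -
      (2 * (z' ⬝ᵥ (P ⊙ P) *ᵥ z) + 2 * ((z ^ 2) ⬝ᵥ (P ⊙ P) *ᵥ z) - 2 * cubicForm P z)) := by
  have hsum : ∑ i, P i i * (3 * ρ i * y i ^ 2 - 2 * y i ^ 3 + ρ i ^ 3 / q
        - 3 / 2 * ρ i * (z i - ρ i) ^ 2 - (z i - ρ i) ^ 3) =
      1 / 2 * ∑ i, (P i i * ρ i * (z i ^ 2 + 2 * y i ^ 2 - (1 - 2 / q) * ρ i ^ 2) +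
        P i i * (2 * (z i * z' i) - 4 * y i ^ 3 - 2 * (1 - 2 / q) * (ρ i * ρ' i))) -
      ∑ i, P i i * (z' i * (z i - ρ i)) - ∑ i, P i i * ((z ^ 2) i * (z i - ρ i)) := by
    rw [Finset.mul_sum, ← Finset.sum_sub_distrib, ← Finset.sum_sub_distrib]
    refine Finset.sum_congr rfl fun i _ => ?_
    rw [Pi.pow_apply]
    linear_combination -(P i i * ρ i) * hz' i
  rw [third, hV.dotProduct_hadamard_mulVec, hV.dotProduct_hadamard_mulVec, hsum]
  ring

end LewisVelocity

variable {ι κ : Type*} [Fintype ι] [DecidableEq ι] [Fintype κ] [DecidableEq κ] {A : Matrix ι κ ℝ}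
  {q : ℝ} {l z y : ℝ → ι → ℝ} {z' : ι → ℝ} {t : ℝ}

theorem hasDerivAt_hadamard_levProj_mulVec (hA : Function.Injective A.mulVec)
    (hl : HasDerivAt l (z t) t) (hz : HasDerivAt z z' t) (i : ι) :
    HasDerivAt (fun r => ((levProj A (l r) ⊙ levProj A (l r)) *ᵥ z r) i)
      (((levProj A (l t) ⊙ levProj A (l t)) *ᵥ z') i +
        z t i * ((levProj A (l t) ⊙ levProj A (l t)) *ᵥ z t) i +
        ((levProj A (l t) ⊙ levProj A (l t)) *ᵥ (z t ^ 2)) i -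
        2 * ∑ j, compression (levProj A (l t)) (z t) i j ^ 2) t := by
  simp only [hadamard_self_mulVec_apply, ← sum_mul_compression (isStarProjection_levProj hA _)]
  refine (HasDerivAt.fun_sum fun j _ => (hasDerivAt_levProj_sq hA hl i j).mul
    (hasDerivAt_pi.mp hz j)).congr_deriv ?_
  simp only [Finset.mul_sum, ← Finset.sum_add_distrib, ← Finset.sum_sub_distrib, Pi.pow_apply]
  exact Finset.sum_congr rfl fun j _ => by ring

theorem hasDerivAt_dotProduct_hadamard_levProj_mulVec (hA : Function.Injective A.mulVec)
    (hl : HasDerivAt l (z t) t) (hz : HasDerivAt z z' t) :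
    HasDerivAt (fun r => z r ⬝ᵥ (levProj A (l r) ⊙ levProj A (l r)) *ᵥ z r)
      (2 * (z' ⬝ᵥ (levProj A (l t) ⊙ levProj A (l t)) *ᵥ z t) +
        2 * ((z t ^ 2) ⬝ᵥ (levProj A (l t) ⊙ levProj A (l t)) *ᵥ z t) -
        2 * cubicForm (levProj A (l t)) (z t)) t := by
  have hP := isStarProjection_levProj hA (l t)
  refine (HasDerivAt.fun_sum fun i _ => (hasDerivAt_pi.mp hz i).mul
    (hasDerivAt_hadamard_levProj_mulVec hA hl hz i)).congr_deriv ?_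
  have hcomm := dotProduct_hadamard_self_mulVec_comm hP
  set Q := levProj A (l t) ⊙ levProj A (l t)
  calc _ = z' ⬝ᵥ Q *ᵥ z t + z t ⬝ᵥ Q *ᵥ z' + (z t ^ 2) ⬝ᵥ Q *ᵥ z t + z t ⬝ᵥ Q *ᵥ (z t ^ 2) -
        2 * cubicForm (levProj A (l t)) (z t) := by
        rw [cubicForm, Finset.mul_sum]
        simp only [dotProduct, Pi.pow_apply, ← Finset.sum_add_distrib, ← Finset.sum_sub_distrib]
        exact Finset.sum_congr rfl fun i _ => by ring
    _ = 2 * (z' ⬝ᵥ Q *ᵥ z t) + 2 * ((z t ^ 2) ⬝ᵥ Q *ᵥ z t) -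
        2 * cubicForm (levProj A (l t)) (z t) := by
        rw [hcomm (z t) z', hcomm (z t) (z t ^ 2)]
        ring

section NonDegenerate

variable (hA : Function.Injective A.mulVec) (hA0 : ∀ i, A i ≠ 0)
include hA hA0

theorem sum_lev_mul_levVelocity (l z : ι → ℝ) : ∑ i, lev A l i * levVelocity A l z i = 0 := by
  have hP := isStarProjection_levProj hA l
  have hone : (1 : ι → ℝ) ⬝ᵥ (levProj A l ⊙ levProj A l) *ᵥ z = ∑ i, lev A l i * z i := by
    rw [← dotProduct_hadamard_self_mulVec_comm hP, dotProduct]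
    refine Finset.sum_congr rfl fun i _ => ?_
    rw [hadamard_self_mulVec_apply]
    simp only [Pi.one_apply, mul_one]
    rw [sum_starProjection_apply_sq hP, mul_comm, lev]
  simp only [lev_mul_levVelocity hA hA0, Finset.sum_sub_distrib, ← hone, one_dotProduct, sub_self]

theorem hasDerivAt_logDet_of_lewis (hl : HasDerivAt l (z t) t) {y : ι → ℝ}
    (hz : ∀ i, z t i = (1 - 2 / q) * levVelocity A (l t) (z t) i - 2 * y i) :
    HasDerivAt (fun r => logDet A (l r)) (-2 * ∑ i, lev A (l t) i * y i) t := by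
  refine (hasDerivAt_logDet hA hl).congr_deriv ?_
  calc ∑ i, lev A (l t) i * z t i
      = (1 - 2 / q) * ∑ i, lev A (l t) i * levVelocity A (l t) (z t) i -
          2 * ∑ i, lev A (l t) i * y i := by
        rw [Finset.mul_sum, Finset.mul_sum, ← Finset.sum_sub_distrib]
        exact Finset.sum_congr rfl fun i _ => by rw [hz]; ring
    _ = -2 * ∑ i, lev A (l t) i * y i := by
        rw [sum_lev_mul_levVelocity hA hA0]
        ring

theorem hasDerivAt_neg_sum_lev_mul (hl : HasDerivAt l (z t) t)
    (hy : ∀ i, HasDerivAt (fun r => y r i) (-y t i ^ 2) t) :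
    HasDerivAt (fun r => -∑ i, lev A (l r) i * y r i)
      (LewisVelocity.second (levProj A (l t)) (y t) (levVelocity A (l t) (z t))) t := by
  refine (HasDerivAt.fun_sum fun i _ => (hasDerivAt_lev hA hl i).mul (hy i)).neg.congr_deriv ?_
  rw [LewisVelocity.second, ← Finset.sum_neg_distrib]
  refine Finset.sum_congr rfl fun i _ => ?_
  rw [← lev_mul_levVelocity hA hA0, ← lev]
  ring

theorem differentiableAt_levVelocity (hl : HasDerivAt l (z t) t) (hz : HasDerivAt z z' t) (i : ι) :
    DifferentiableAt ℝ (fun r => levVelocity A (l r) (z r) i) t :=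
  (hasDerivAt_pi.mp hz i).differentiableAt.sub
    ((hasDerivAt_hadamard_levProj_mulVec hA hl hz i).differentiableAt.div
      (hasDerivAt_lev hA hl i).differentiableAt (lev_pos hA hA0 (l t) i).ne')

theorem hasDerivAt_second (hl : HasDerivAt l (z t) t) (hz : HasDerivAt z z' t)
    (hy : ∀ i, HasDerivAt (fun r => y r i) (-y t i ^ 2) t)
    (hlewis : ∀ᶠ r in 𝓝 t, ∀ i,
      z r i = (1 - 2 / q) * levVelocity A (l r) (z r) i - 2 * y r i) :
    HasDerivAt
      (fun r => LewisVelocity.second (levProj A (l r)) (y r) (levVelocity A (l r) (z r)))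
      (LewisVelocity.third (levProj A (l t)) q (y t) (z t) (levVelocity A (l t) (z t))) t := by
  have hzi := hasDerivAt_pi.mp hz
  obtain ⟨ρ', hρ⟩ : ∃ ρ' : ι → ℝ, ∀ i,
      HasDerivAt (fun r => levVelocity A (l r) (z r) i) (ρ' i) t :=
    ⟨_, fun i => (differentiableAt_levVelocity hA hA0 hl hz i).hasDerivAt⟩
  have hz' : ∀ i, z' i = (1 - 2 / q) * ρ' i + 2 * y t i ^ 2 := fun i => by
    have hright := (((hρ i).const_mul (1 - 2 / q)).sub ((hy i).const_mul 2)).congr_of_eventuallyEq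
      (hlewis.mono fun r hr => hr i)
    rw [(hzi i).unique hright]
    ring
  have hV := lewisVelocity_levVelocity hA hA0 hlewis.self_of_nhds
  have hsecond := hlewis.mono fun r hr =>
    (lewisVelocity_levVelocity hA hA0 hr).second_eq_sub_dotProduct
  refine HasDerivAt.congr_of_eventuallyEq ?_ hsecond
  rw [hV.third_eq hz']
  refine (((HasDerivAt.fun_sum fun i _ => (hasDerivAt_lev hA hl i).mul
    ((((hzi i).fun_pow 2).fun_add (((hy i).fun_pow 2).const_mul 2)).fun_sub
      (((hρ i).fun_pow 2).const_mul (1 - 2 / q)))).sub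
    (hasDerivAt_dotProduct_hadamard_levProj_mulVec hA hl hz)).const_mul (1 / 2)).congr_deriv ?_
  congr 2
  refine Finset.sum_congr rfl fun i _ => ?_
  rw [← lev_mul_levVelocity hA hA0, ← lev]
  push_cast
  ring

end NonDegenerate

end LewisCurve

section BarrierDerivatives

theorem hasDerivAt_iteratedFDeriv_line {E : Type*} [NormedAddCommGroup E] [NormedSpace ℝ E]
    {f : E → ℝ} {x h : E} {t : ℝ} {k : ℕ} (hf : ContDiffAt ℝ (k + 1) f (x + t • h)) :
    HasDerivAt (fun r : ℝ => iteratedFDeriv ℝ k f (x + r • h) fun _ => h)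
      (iteratedFDeriv ℝ (k + 1) f (x + t • h) fun _ => h) t := by
  have hdiff : DifferentiableAt ℝ (iteratedFDeriv ℝ k f) (x + t • h) :=
    hf.differentiableAt_iteratedFDeriv (by exact_mod_cast lt_add_one k)
  have hline : DifferentiableAt ℝ (fun r : ℝ => x + r • h) t := by fun_prop
  rw [← hf.deriv_fderiv_add_smul]
  exact ((hdiff.comp t hline).continuousMultilinear_apply_const _).hasDerivAt

variable {m n : ℕ} {A : Matrix (Fin m) (Fin n) ℝ} {q : ℝ} {b : Fin m → ℝ} {x h : Fin n → ℝ}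

theorem isOpen_interiorSet (A : Matrix (Fin m) (Fin n) ℝ) (b : Fin m → ℝ) :
    IsOpen (interiorSet A b) := by
  simp only [interiorSet, Set.ofPred_forall]
  exact isOpen_iInter_of_finite fun i => isOpen_lt continuous_const (by fun_prop)

theorem exists_local_isLewis (hA : NonDegenerate A) (hq : 0 < q) (hx : x ∈ interiorSet A b)
    {k : WithTop ℕ∞} (hk : k ≠ 0) :
    ∃ L : (Fin n → ℝ) → Fin m → ℝ, ContDiffAt ℝ k L x ∧ ∀ᶠ y in 𝓝 x, IsLewis q A b y (L y) := by
  obtain ⟨l, hl⟩ := exists_isLewis hA hq b x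
  obtain ⟨g, hg, hinv⟩ := exists_local_inverse_lewisMap hA.injective hA.2 hq hk l
  set s : (Fin n → ℝ) → Fin m → ℝ := fun y i => -2 * Real.log ((A *ᵥ y) i - b i)
  rw [show lewisMap A q l = s x from funext hl] at hg hinv
  have hs : ContDiffAt ℝ k s x := contDiffAt_pi.mpr fun i => by
    refine contDiffAt_const.mul (ContDiffAt.log ?_ (sub_pos.mpr (hx i)).ne')
    simp only [Matrix.mulVec, dotProduct]
    fun_prop
  exact ⟨g ∘ s, hg.comp x hs, (hs.continuousAt.eventually hinv).mono fun y hy => congrFun hy⟩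

theorem contDiffAt_barrier (hA : NonDegenerate A) (hq : 0 < q) (hx : x ∈ interiorSet A b)
    {k : WithTop ℕ∞} (hk : k ≠ 0) : ContDiffAt ℝ k (barrier q A b) x := by
  obtain ⟨L, hL, hlewis⟩ := exists_local_isLewis hA hq hx hk
  have heq : barrier q A b =ᶠ[𝓝 x] fun y => lewisValue q A (L y) := by
    filter_upwards [hlewis, (isOpen_interiorSet A b).mem_nhds hx] with y hly hy
    exact hly.barrier_eq hA hy hq
  exact ContDiffAt.congr_of_eventuallyEq (contDiffAt_const.mul
    (((contDiff_logDet hA.injective).contDiffAt.comp x hL).sub contDiffAt_const)) heq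

/-- The logarithmic derivative of the slacks `A x - b` in the direction `h`. -/
def slackVelocity (A : Matrix (Fin m) (Fin n) ℝ) (b : Fin m → ℝ) (x h : Fin n → ℝ)
    (i : Fin m) : ℝ :=
  (A *ᵥ h) i / ((A *ᵥ x) i - b i)

section Line

variable {l z : ℝ → Fin m → ℝ} {t : ℝ}

theorem eventually_add_smul_mem_interiorSet (hx : x + t • h ∈ interiorSet A b) :
    ∀ᶠ r : ℝ in 𝓝 t, x + r • h ∈ interiorSet A b :=
  ContinuousAt.eventually_mem (f := fun r : ℝ => x + r • h) (by fun_prop)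
    ((isOpen_interiorSet A b).mem_nhds hx)

theorem hasDerivAt_slack (A : Matrix (Fin m) (Fin n) ℝ) (b : Fin m → ℝ) (x h : Fin n → ℝ) (t : ℝ)
    (i : Fin m) : HasDerivAt (fun r : ℝ => (A *ᵥ (x + r • h)) i - b i) ((A *ᵥ h) i) t := by
  simp only [Matrix.mulVec_add, Matrix.mulVec_smul, Pi.add_apply, Pi.smul_apply, smul_eq_mul]
  exact ((hasDerivAt_mul_const _).const_add _).sub_const _

theorem hasDerivAt_slackVelocity (hx : x + t • h ∈ interiorSet A b) (i : Fin m) :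
    HasDerivAt (fun r : ℝ => slackVelocity A b (x + r • h) h i)
      (-slackVelocity A b (x + t • h) h i ^ 2) t := by
  have hs : (A *ᵥ (x + t • h)) i - b i ≠ 0 := (sub_pos.mpr (hx i)).ne'
  refine ((hasDerivAt_const t _).div (hasDerivAt_slack A b x h t i) hs).congr_deriv ?_
  rw [slackVelocity, zero_mul, zero_sub, ← sq, neg_div, div_pow]

variable (hA : NonDegenerate A) (hx : x + t • h ∈ interiorSet A b)
  (hlewis : ∀ᶠ r in 𝓝 t, IsLewis q A b (x + r • h) (l r))
include hA hx hlewis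

theorem IsLewis.velocity_eq (hl : HasDerivAt l (z t) t) (i : Fin m) :
    z t i = (1 - 2 / q) * levVelocity A (l t) (z t) i - 2 * slackVelocity A b (x + t • h) h i := by
  have hs : (A *ᵥ (x + t • h)) i - b i ≠ 0 := (sub_pos.mpr (hx i)).ne'
  have hright := ((hasDerivAt_slack A b x h t i).log hs).const_mul (-2)
  have hunique := (hasDerivAt_lewisMap hA.injective hA.2 hl i).unique
    (hright.congr_of_eventuallyEq (hlewis.mono fun r hr => hr i))
  rw [slackVelocity]
  linarith

variable (hq : 0 < q)
include hq

theorem iteratedFDeriv_one_barrier_line (hl : HasDerivAt l (z t) t) :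
    (iteratedFDeriv ℝ 1 (barrier q A b) (x + t • h) fun _ => h) =
      -∑ i, lev A (l t) i * slackVelocity A b (x + t • h) h i := by
  have hvalue : ∀ᶠ r in 𝓝 t, barrier q A b (x + r • h) = lewisValue q A (l r) := by
    filter_upwards [eventually_add_smul_mem_interiorSet hx, hlewis] with r hr hlr
    exact hlr.barrier_eq hA hr hq
  have hderiv := hasDerivAt_iteratedFDeriv_line (k := 0) (contDiffAt_barrier hA hq hx (by simp))
  simp only [iteratedFDeriv_zero_apply] at hderiv
  refine hderiv.unique (HasDerivAt.congr_of_eventuallyEq ?_ hvalue)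
  refine (((hasDerivAt_logDet_of_lewis hA.injective hA.2 hl
    (IsLewis.velocity_eq hA hx hlewis hl)).sub_const _).const_mul (1 / 2)).congr_deriv ?_
  ring

theorem iteratedFDeriv_two_barrier_line (hl : ∀ᶠ r in 𝓝 t, HasDerivAt l (z r) r) :
    (iteratedFDeriv ℝ 2 (barrier q A b) (x + t • h) fun _ => h) =
      LewisVelocity.second (levProj A (l t)) (slackVelocity A b (x + t • h) h)
        (levVelocity A (l t) (z t)) := by
  have hfirst : ∀ᶠ r in 𝓝 t, (iteratedFDeriv ℝ 1 (barrier q A b) (x + r • h) fun _ => h) =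
      -∑ i, lev A (l r) i * slackVelocity A b (x + r • h) h i := by
    filter_upwards [eventually_add_smul_mem_interiorSet hx, hlewis.eventually_nhds, hl]
      with r hr hlr hdr
    exact iteratedFDeriv_one_barrier_line hA hr hlr hq hdr
  have hderiv := hasDerivAt_iteratedFDeriv_line (k := 1) (contDiffAt_barrier hA hq hx (by simp))
  exact hderiv.unique ((hasDerivAt_neg_sum_lev_mul hA.injective hA.2 hl.self_of_nhds
    (hasDerivAt_slackVelocity hx)).congr_of_eventuallyEq hfirst)

theorem iteratedFDeriv_three_barrier_line {z' : Fin m → ℝ}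
    (hl : ∀ᶠ r in 𝓝 t, HasDerivAt l (z r) r) (hz : HasDerivAt z z' t) :
    (iteratedFDeriv ℝ 3 (barrier q A b) (x + t • h) fun _ => h) =
      LewisVelocity.third (levProj A (l t)) q (slackVelocity A b (x + t • h) h) (z t)
        (levVelocity A (l t) (z t)) := by
  have hx' := eventually_add_smul_mem_interiorSet hx
  have hsecond : ∀ᶠ r in 𝓝 t, (iteratedFDeriv ℝ 2 (barrier q A b) (x + r • h) fun _ => h) =
      LewisVelocity.second (levProj A (l r)) (slackVelocity A b (x + r • h) h)
        (levVelocity A (l r) (z r)) := by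
    filter_upwards [hx', hlewis.eventually_nhds, hl.eventually_nhds] with r hr hlr hdr
    exact iteratedFDeriv_two_barrier_line hA hr hlr hq hdr
  have hvelocity : ∀ᶠ r in 𝓝 t, ∀ i, z r i =
      (1 - 2 / q) * levVelocity A (l r) (z r) i - 2 * slackVelocity A b (x + r • h) h i := by
    filter_upwards [hx', hlewis.eventually_nhds, hl] with r hr hlr hdr
    exact IsLewis.velocity_eq hA hr hlr hdr
  have hderiv := hasDerivAt_iteratedFDeriv_line (k := 2) (contDiffAt_barrier hA hq hx (by simp))
  exact hderiv.unique ((hasDerivAt_second hA.injective hA.2 hl.self_of_nhds hz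
    (hasDerivAt_slackVelocity hx) hvelocity).congr_of_eventuallyEq hsecond)

end Line

theorem barrier_derivatives (hA : NonDegenerate A) (hq : 0 < q) (hx : x ∈ interiorSet A b)
    (h : Fin n → ℝ) :
    ∃ l z ρ : Fin m → ℝ, IsLewis q A b x l ∧
      LewisVelocity (levProj A l) q (slackVelocity A b x h) z ρ ∧
      fderiv ℝ (barrier q A b) x h = -∑ i, lev A l i * slackVelocity A b x h i ∧
      iteratedFDeriv ℝ 2 (barrier q A b) x ![h, h] =
        LewisVelocity.second (levProj A l) (slackVelocity A b x h) ρ ∧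
      iteratedFDeriv ℝ 3 (barrier q A b) x ![h, h, h] =
        LewisVelocity.third (levProj A l) q (slackVelocity A b x h) z ρ := by
  obtain ⟨L, hL, hlewis⟩ := exists_local_isLewis hA hq hx (k := 2) two_ne_zero
  have hx0 : x = x + (0 : ℝ) • h := by rw [zero_smul, add_zero]
  rw [hx0] at hx hL hlewis
  set l : ℝ → Fin m → ℝ := fun r => L (x + r • h)
  have hline : ContDiff ℝ 2 fun r : ℝ => x + r • h := by fun_prop
  have hl : ContDiffAt ℝ 2 l 0 := hL.comp (0 : ℝ) hline.contDiffAt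
  have hlewis' : ∀ᶠ r in 𝓝 (0 : ℝ), IsLewis q A b (x + r • h) (l r) :=
    hline.continuous.continuousAt.eventually hlewis
  have hl' : ∀ᶠ r in 𝓝 0, HasDerivAt l (deriv l r) r := by
    filter_upwards [hl.eventually (by simp)] with r hr
    exact (hr.differentiableAt two_ne_zero).hasDerivAt
  have hl'' : HasDerivAt (deriv l) (deriv (deriv l) 0) 0 := by
    have hfderiv : ContDiffAt ℝ 1 (fderiv ℝ l) 0 := hl.fderiv_right (by norm_num)
    exact ((hfderiv.differentiableAt one_ne_zero).clm_apply
      (differentiableAt_const (1 : ℝ))).hasDerivAt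
  have hvelocity := IsLewis.velocity_eq hA hx hlewis' hl'.self_of_nhds
  have hfirst := iteratedFDeriv_one_barrier_line hA hx hlewis' hq hl'.self_of_nhds
  have hsecond := iteratedFDeriv_two_barrier_line hA hx hlewis' hq hl'
  have hthird := iteratedFDeriv_three_barrier_line hA hx hlewis' hq hl' hl''
  rw [← hx0] at hvelocity hfirst hsecond hthird
  rw [iteratedFDeriv_one_apply] at hfirst
  rw [show ![h, h, h] = fun _ => h from List.ofFn_inj.mp rfl,
    show ![h, h] = fun _ => h from List.ofFn_inj.mp rfl]
  exact ⟨l 0, deriv l 0, levVelocity A (l 0) (deriv l 0), hx0 ▸ hlewis.self_of_nhds,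
    lewisVelocity_levVelocity hA.injective hA.2 hvelocity, hfirst, hsecond, hthird⟩

end BarrierDerivatives

section Derivatives

variable {n : ℕ}

theorem fderiv_eq_dotProduct (φ : (Fin n → ℝ) → ℝ) (x h : Fin n → ℝ) :
    fderiv ℝ φ x h = grad φ x ⬝ᵥ h := by
  have hbasis : ∀ i, Pi.single i (h i) = h i • (Pi.single i 1 : Fin n → ℝ) := fun i => by
    rw [← Pi.single_smul, smul_eq_mul, mul_one]
  conv_lhs => rw [← Finset.univ_sum_single h]
  simp only [hbasis, map_sum, map_smul, smul_eq_mul, mul_comm (h _), grad, dotProduct]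

theorem iteratedFDeriv_two_eq_dotProduct (φ : (Fin n → ℝ) → ℝ) (x h : Fin n → ℝ) :
    iteratedFDeriv ℝ 2 φ x ![h, h] = h ⬝ᵥ (hess φ x *ᵥ h) := by
  have hess_eq : hess φ x = LinearMap.toMatrix₂' ℝ (fderiv ℝ (fderiv ℝ φ) x).toLinearMap₁₂ := by
    ext i j
    simp [hess, iteratedFDeriv_two_apply]
  rw [hess_eq, ← Matrix.toLinearMap₂'_apply', Matrix.toLinearMap₂'_toMatrix',
    iteratedFDeriv_two_apply]
  rfl

theorem isSymm_hess {φ : (Fin n → ℝ) → ℝ} {x : Fin n → ℝ} (hφ : ContDiffAt ℝ 2 φ x) :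
    (hess φ x).IsSymm := by
  have hsymm : IsSymmSndFDerivAt ℝ φ x := hφ.isSymmSndFDerivAt (by simp)
  ext i j
  simpa [hess, iteratedFDeriv_two_apply] using hsymm (Pi.single j 1) (Pi.single i 1)

theorem convexOn_of_iteratedFDeriv_two_nonneg {E : Type*} [NormedAddCommGroup E] [NormedSpace ℝ E]
    {K : Set E} {f : E → ℝ} (hK : Convex ℝ K) (hf : ∀ x ∈ K, ContDiffAt ℝ 2 f x)
    (hf'' : ∀ x ∈ K, ∀ h, 0 ≤ iteratedFDeriv ℝ 2 f x fun _ => h) : ConvexOn ℝ K f := by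
  refine ⟨hK, fun x hx y hy s t hs ht hst => ?_⟩
  have hmem : ∀ r ∈ Set.Icc (0 : ℝ) 1, x + r • (y - x) ∈ K := fun r hr =>
    hK.add_smul_sub_mem hx hy hr
  have hfirst : ∀ r ∈ Set.Icc (0 : ℝ) 1, HasDerivAt (fun r : ℝ => f (x + r • (y - x)))
      (iteratedFDeriv ℝ 1 f (x + r • (y - x)) fun _ => y - x) r := fun r hr => by
    simpa only [iteratedFDeriv_zero_apply] using
      hasDerivAt_iteratedFDeriv_line (k := 0) ((hf _ (hmem r hr)).of_le (by norm_num))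
  have hsecond : ∀ r ∈ Set.Icc (0 : ℝ) 1,
      HasDerivAt (fun r : ℝ => iteratedFDeriv ℝ 1 f (x + r • (y - x)) fun _ => y - x)
        (iteratedFDeriv ℝ 2 f (x + r • (y - x)) fun _ => y - x) r := fun r hr =>
    hasDerivAt_iteratedFDeriv_line (k := 1) ((hf _ (hmem r hr)).of_le (by norm_num))
  have hline : ConvexOn ℝ (Set.Icc (0 : ℝ) 1) fun r : ℝ => f (x + r • (y - x)) :=
    convexOn_of_hasDerivWithinAt2_nonneg (convex_Icc 0 1)
      (fun r hr => (hfirst r hr).continuousAt.continuousWithinAt)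
      (fun r hr => (hfirst r (interior_subset hr)).hasDerivWithinAt)
      (fun r hr => (hsecond r (interior_subset hr)).hasDerivWithinAt)
      (fun r hr => hf'' _ (hmem r (interior_subset hr)) _)
  have hconv := hline.2 (Set.left_mem_Icc.mpr zero_le_one) (Set.right_mem_Icc.mpr zero_le_one)
    hs ht hst
  have hcomb : x + t • (y - x) = s • x + t • y := by
    rw [eq_sub_of_add_eq hst]
    module
  simpa only [smul_eq_mul, mul_zero, mul_one, zero_add, zero_smul, add_zero, one_smul, hcomb,
    add_sub_cancel] using hconv

end Derivatives

section BarrierBounds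

variable {m n : ℕ} {A : Matrix (Fin m) (Fin n) ℝ} {q : ℝ} {b : Fin m → ℝ} {x : Fin n → ℝ}

theorem IsLewis.abs_slackVelocity_le (hA : NonDegenerate A) (hq : 0 < q)
    (hx : x ∈ interiorSet A b) {l : Fin m → ℝ} (hl : IsLewis q A b x l) (h : Fin n → ℝ)
    (i : Fin m) :
    |slackVelocity A b x h i| ≤
      (m : ℝ) ^ (1 / (q + 2)) * √(∑ j, lev A l j * slackVelocity A b x h j ^ 2) := by
  have hlev := lev_pos hA.injective hA.2 l
  have hhat := hat_self_pos hA.injective hA.2 l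
  set c : Fin m → ℝ := fun j => (A *ᵥ h) j ^ 2 / hat A l j j
  have hc : ∀ j, 0 ≤ c j := fun j => div_nonneg (sq_nonneg _) (hhat j).le
  have hslack : ∀ j, slackVelocity A b x h j ^ 2 = lev A l j ^ (2 / q) * c j := fun j => by
    have hrpow := (Real.rpow_pos_of_pos (hlev j) (2 / q)).ne'
    rw [slackVelocity, div_pow]
    simp only [c, hl.hat_self hA hx j, ← div_div]
    field_simp
  have hbound : ∀ j, c j ≤ ∑ k, lev A l k * c k := fun j => by
    rw [div_le_iff₀' (hhat j)]
    refine (mulVec_sq_le hA.injective l h j).trans_eq (congrArg _ (Finset.sum_congr rfl ?_))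
    intro k _
    simp only [c, lev_eq_exp_mul, mul_assoc, mul_div_cancel₀ _ (hhat k).ne']
  have hsum : ∀ j, lev A l j ^ (1 + 2 / q) * c j = lev A l j * slackVelocity A b x h j ^ 2 :=
    fun j => by rw [hslack, Real.rpow_add (hlev j), Real.rpow_one, mul_assoc]
  have hexp : 1 - (1 + 2 / q)⁻¹ = 1 / (q + 2) * (2 : ℕ) := by
    field_simp
    push_cast
    ring
  have hsq := rpow_mul_le_card_rpow_mul_sum
    (le_add_of_nonneg_right (by positivity : 0 ≤ 2 / q))
    (fun j => (hlev j).le) hc hbound i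
  simp only [hsum, hexp, add_sub_cancel_left, ← hslack, Fintype.card_fin,
    Real.rpow_mul_natCast (Nat.cast_nonneg m)] at hsq
  refine abs_le_of_sq_le_sq (hsq.trans_eq ?_) (by positivity)
  rw [mul_pow, Real.sq_sqrt (Finset.sum_nonneg fun j _ => mul_nonneg (hlev j).le (sq_nonneg _))]

theorem concordanceConst_pos (hq : 0 < q) : 0 < concordanceConst q m := by
  exact add_pos_of_nonneg_of_pos (by positivity)
    (mul_pos four_pos (Real.rpow_pos_of_pos (lt_max_of_lt_left hq) _))

section

variable (hA : NonDegenerate A) (hq : 0 < q) (hx : x ∈ interiorSet A b)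
include hA hq hx

theorem abs_third_barrier_le (h : Fin n → ℝ) :
    |iteratedFDeriv ℝ 3 (barrier q A b) x ![h, h, h]| ≤
      2 * concordanceConst q m * √(iteratedFDeriv ℝ 2 (barrier q A b) x ![h, h]) ^ 3 := by
  obtain ⟨l, z, ρ, hl, hV, -, hsecond, hthird⟩ := barrier_derivatives hA hq hx h
  rw [hsecond, hthird]
  exact hV.abs_third_le (isStarProjection_levProj hA.injective l)
    (lev_pos hA.injective hA.2 l) hq (by positivity) (hl.abs_slackVelocity_le hA hq hx h)

theorem exists_first_eq_and_le_second (h : Fin n → ℝ) :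
    ∃ l : Fin m → ℝ, fderiv ℝ (barrier q A b) x h = -∑ i, lev A l i * slackVelocity A b x h i ∧
      ∑ i, lev A l i * slackVelocity A b x h i ^ 2 ≤
        iteratedFDeriv ℝ 2 (barrier q A b) x ![h, h] := by
  obtain ⟨l, z, ρ, -, hV, hfirst, hsecond, -⟩ := barrier_derivatives hA hq hx h
  have hle := hV.sum_slack_sq_le (isStarProjection_levProj hA.injective l) hq
  exact ⟨l, hfirst, hle.trans_eq hsecond.symm⟩

theorem second_barrier_pos {h : Fin n → ℝ} (hh : h ≠ 0) :
    0 < iteratedFDeriv ℝ 2 (barrier q A b) x ![h, h] := by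
  obtain ⟨l, -, hle⟩ := exists_first_eq_and_le_second hA hq hx h
  have hlev := lev_pos hA.injective hA.2 l
  have hAh : A *ᵥ h ≠ 0 := fun hzero => hh (hA.injective (hzero.trans (Matrix.mulVec_zero A).symm))
  obtain ⟨i, hi⟩ := Function.ne_iff.mp hAh
  have hslack : slackVelocity A b x h i ≠ 0 := div_ne_zero hi (sub_pos.mpr (hx i)).ne'
  exact (Finset.sum_pos' (fun j _ => mul_nonneg (hlev j).le (sq_nonneg _))
    ⟨i, Finset.mem_univ i, mul_pos (hlev i) (sq_pos_of_ne_zero hslack)⟩).trans_le hle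

theorem second_barrier_nonneg (h : Fin n → ℝ) :
    0 ≤ iteratedFDeriv ℝ 2 (barrier q A b) x ![h, h] := by
  obtain ⟨l, -, hle⟩ := exists_first_eq_and_le_second hA hq hx h
  exact (Finset.sum_nonneg fun i _ =>
    mul_nonneg (lev_pos hA.injective hA.2 l i).le (sq_nonneg _)).trans hle

theorem first_barrier_sq_le (h : Fin n → ℝ) :
    fderiv ℝ (barrier q A b) x h ^ 2 ≤ n * iteratedFDeriv ℝ 2 (barrier q A b) x ![h, h] := by
  obtain ⟨l, hfirst, hle⟩ := exists_first_eq_and_le_second hA hq hx h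
  have hlev := lev_pos hA.injective hA.2 l
  calc fderiv ℝ (barrier q A b) x h ^ 2 = (∑ i, lev A l i * slackVelocity A b x h i) ^ 2 := by
        rw [hfirst, neg_sq]
    _ ≤ (∑ i, lev A l i) * ∑ i, lev A l i * slackVelocity A b x h i ^ 2 :=
        Finset.sum_sq_le_sum_mul_sum_of_sq_le_mul _ (fun i _ => (hlev i).le)
          (fun i _ => mul_nonneg (hlev i).le (sq_nonneg _)) fun i _ => le_of_eq (by ring)
    _ ≤ n * iteratedFDeriv ℝ 2 (barrier q A b) x ![h, h] := by
        rw [sum_lev hA.injective, Fintype.card_fin]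
        gcongr

theorem hess_barrier_posDef : (hess (barrier q A b) x).PosDef := by
  refine Matrix.PosDef.of_dotProduct_mulVec_pos ?_ fun h hh => ?_
  · exact isSymm_hess (contDiffAt_barrier hA hq hx two_ne_zero)
  · rw [star_trivial, ← iteratedFDeriv_two_eq_dotProduct]
    exact second_barrier_pos hA hq hx hh

end

theorem dotProduct_inv_mulVec_le {κ : Type*} [Fintype κ] [DecidableEq κ] {B : Matrix κ κ ℝ}
    (hB : B.PosDef) {g : κ → ℝ} {c : ℝ} (hc : 0 ≤ c)
    (h : ∀ v, (g ⬝ᵥ v) ^ 2 ≤ c * (v ⬝ᵥ B *ᵥ v)) :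
    g ⬝ᵥ B⁻¹ *ᵥ g ≤ c := by
  have hself := h (B⁻¹ *ᵥ g)
  rw [Matrix.mulVec_mulVec, Matrix.mul_nonsing_inv _ hB.det_pos.ne'.isUnit, Matrix.one_mulVec,
    dotProduct_comm (B⁻¹ *ᵥ g), sq] at hself
  rcases le_or_gt (g ⬝ᵥ B⁻¹ *ᵥ g) 0 with hle | hpos
  · exact hle.trans hc
  · exact le_of_mul_le_mul_right hself hpos

end BarrierBounds

section BoundaryBehaviour

variable {m n : ℕ} {A : Matrix (Fin m) (Fin n) ℝ} {q : ℝ} {b : Fin m → ℝ} {x : Fin n → ℝ}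

theorem le_barrier_of_two_le (hA : NonDegenerate A) (hq : 2 ≤ q) (hx : x ∈ interiorSet A b) :
    1 / 2 * (logDet A 0 - (1 - 2 / q) * m) - ∑ i, lev A 0 i * Real.log ((A *ᵥ x) i - b i) ≤
      barrier q A b x := by
  have hq0 : 0 < q := two_pos.trans_le hq
  obtain ⟨l, hl⟩ := exists_isLewis hA hq0 b x
  have hone : ∀ _ : Fin m, (0 : ℝ) < 1 := fun _ => one_pos
  have hmax := (hl.isGreatest hA hx hq).2 ⟨_, mem_admissibleWeights hA.injective hx hone, rfl⟩
  rw [hl.barrier_eq hA hx hq0]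
  refine le_trans ?_ hmax
  have htangent := le_logDet hA.injective 0 fun i =>
    (1 - 2 / q) * Real.log 1 - 2 * Real.log ((A *ᵥ x) i - b i)
  simp only [Real.log_one, mul_zero, zero_sub, Pi.zero_apply, sub_zero, mul_neg,
    mul_left_comm _ (2 : ℝ), Finset.sum_neg_distrib, ← Finset.mul_sum] at htangent
  simp only [potential_eq hx hone, Real.log_one, mul_zero, zero_sub, Finset.sum_const,
    Finset.card_univ, Fintype.card_fin, nsmul_eq_mul, mul_one]
  linarith

theorem le_barrier_of_le_two (hA : NonDegenerate A) (hq : 0 < q) (hq2 : q ≤ 2)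
    (hx : x ∈ interiorSet A b) :
    1 / 2 * (logDet A 0 - (1 - 2 / q) * n) - ∑ i, lev A 0 i * Real.log ((A *ᵥ x) i - b i) ≤
      barrier q A b x := by
  obtain ⟨l, hl⟩ := exists_isLewis hA hq b x
  have hp : 1 - 2 / q ≤ 0 := sub_nonpos.mpr ((one_le_div hq).mpr hq2)
  have hlog : ∀ i, -2 * Real.log ((A *ᵥ x) i - b i) ≤ l i := fun i => by
    have hnonneg := mul_nonneg_of_nonpos_of_nonpos hp (log_lev_nonpos hA.injective hA.2 l i)
    linarith [hl.apply_eq i]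
  have hsum := Finset.sum_le_sum fun i (_ : i ∈ Finset.univ) =>
    mul_le_mul_of_nonneg_left (hlog i) (lev_pos hA.injective hA.2 0 i).le
  have htangent := le_logDet hA.injective 0 l
  simp only [Pi.zero_apply, sub_zero] at htangent
  simp only [mul_left_comm _ (-2 : ℝ), ← Finset.mul_sum] at hsum
  rw [hl.barrier_eq hA hx hq, lewisValue]
  linarith

theorem exists_forall_le_barrier (hA : NonDegenerate A) (hq : 0 < q) (b : Fin m → ℝ) :
    ∃ C : ℝ, ∀ x ∈ interiorSet A b,
      C - ∑ i, lev A 0 i * Real.log ((A *ᵥ x) i - b i) ≤ barrier q A b x := by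
  rcases le_total 2 q with hq2 | hq2
  · exact ⟨_, fun x hx => le_barrier_of_two_le hA hq2 hx⟩
  · exact ⟨_, fun x hx => le_barrier_of_le_two hA hq hq2 hx⟩

theorem tendsto_sum_mul_log_atBot {ι α : Type*} [Fintype ι] {f : Filter α} {w : ι → ℝ}
    (hw : ∀ i, 0 < w i) {s : α → ι → ℝ} (hs : ∀ k i, 0 < s k i) {s₀ : ι → ℝ}
    (hlim : Tendsto s f (𝓝 s₀)) {i₀ : ι} (hi₀ : s₀ i₀ = 0) :
    Tendsto (fun k => ∑ i, w i * Real.log (s k i)) f atBot := by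
  classical
  have hlim' : ∀ i, Tendsto (fun k => s k i) f (𝓝 (s₀ i)) := tendsto_pi_nhds.mp hlim
  have hlog : Tendsto (fun k => w i₀ * Real.log (s k i₀)) f atBot :=
    (Real.tendsto_log_nhdsGT_zero.comp (tendsto_nhdsWithin_iff.mpr
      ⟨hi₀ ▸ hlim' i₀, Eventually.of_forall fun k => hs k i₀⟩)).const_mul_atBot (hw i₀)
  have hbound : Tendsto (fun k => ∑ i ∈ Finset.univ.erase i₀, w i * (s k i - 1)) f
      (𝓝 (∑ i ∈ Finset.univ.erase i₀, w i * (s₀ i - 1))) :=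
    tendsto_finsetSum _ fun i _ => ((hlim' i).sub_const 1).const_mul (w i)
  refine tendsto_atBot_mono (fun k => ?_) (hlog.atBot_add hbound)
  rw [← Finset.add_sum_erase _ _ (Finset.mem_univ i₀)]
  gcongr with i
  · exact (hw i).le
  · exact Real.log_le_sub_one_of_pos (hs k i)

theorem blowsUp_barrier (hA : NonDegenerate A) (hq : 0 < q) :
    BlowsUpAtBoundary (interiorSet A b) (barrier q A b) := by
  intro u hu p hp hup
  rw [(isOpen_interiorSet A b).frontier_eq] at hp
  obtain ⟨i₀, hi₀⟩ : ∃ i, (A *ᵥ p) i ≤ b i := by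
    by_contra! hpos
    exact hp.2 hpos
  have hslack : Tendsto (fun k i => (A *ᵥ u k) i - b i) atTop (𝓝 fun i => (A *ᵥ p) i - b i) :=
    (Continuous.tendsto (f := fun x i => (A *ᵥ x) i - b i) (by fun_prop) p).comp hup
  have hpos : ∀ k i, 0 < (A *ᵥ u k) i - b i := fun k i => sub_pos.mpr (hu k i)
  have hzero : (A *ᵥ p) i₀ - b i₀ = 0 := (sub_nonpos.mpr hi₀).antisymm
    (ge_of_tendsto' (tendsto_pi_nhds.mp hslack i₀) fun k => (hpos k i₀).le)
  obtain ⟨C, hC⟩ := exists_forall_le_barrier hA hq b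
  refine tendsto_atTop_mono (fun k => hC (u k) (hu k)) ?_
  simp only [sub_eq_add_neg C]
  exact tendsto_atTop_add_const_left _ C (tendsto_neg_atBot_atTop.comp
    (tendsto_sum_mul_log_atBot (lev_pos hA.injective hA.2 0) hpos hslack hzero))

theorem convex_interiorSet (A : Matrix (Fin m) (Fin n) ℝ) (b : Fin m → ℝ) :
    Convex ℝ (interiorSet A b) := by
  simp only [interiorSet, Set.ofPred_forall]
  exact convex_iInter fun i =>
    convex_halfSpace_gt ((LinearMap.proj i ∘ₗ A.mulVecLin).isLinear) (b i)

theorem isBarrier_barrier (hA : NonDegenerate A) (hq : 0 < q) :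
    IsBarrier (interiorSet A b) (barrier q A b) where
  isOpen := isOpen_interiorSet A b
  convexOn := convexOn_of_iteratedFDeriv_two_nonneg (convex_interiorSet A b)
    (fun _ hx => contDiffAt_barrier hA hq hx two_ne_zero) fun _ hx h => by
      rw [show (fun _ => h) = ![h, h] from List.ofFn_inj.mp rfl]
      exact second_barrier_nonneg hA hq hx h
  contDiffOn := fun _ hx => (contDiffAt_barrier hA hq hx three_ne_zero).contDiffWithinAt
  blowsUp := blowsUp_barrier hA hq

end BoundaryBehaviour

section Scaling

variable {n : ℕ} {K : Set (Fin n → ℝ)} {φ : (Fin n → ℝ) → ℝ} {v ν : ℝ}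

theorem IsBarrier.const_mul (hφ : IsBarrier K φ) {c : ℝ} (hc : 0 < c) :
    IsBarrier K fun x => c * φ x where
  isOpen := hφ.isOpen
  convexOn := hφ.convexOn.smul hc.le
  contDiffOn := contDiffOn_const.mul hφ.contDiffOn
  blowsUp := fun u hu p hp hup => (hφ.blowsUp u hu p hp hup).const_mul_atTop hc

theorem abs_sq_mul_le_two_mul_rpow {d₂ d₃ : ℝ} (hv : 0 ≤ v) (hd₂ : 0 ≤ d₂)
    (h : |d₃| ≤ 2 * v * √d₂ ^ 3) : |v ^ 2 * d₃| ≤ 2 * |v ^ 2 * d₂| ^ (3 / 2 : ℝ) := by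
  rw [abs_mul, abs_of_nonneg (sq_nonneg v), abs_of_nonneg (by positivity : 0 ≤ v ^ 2 * d₂),
    rpow_three_halves (by positivity), Real.sqrt_mul (sq_nonneg v), Real.sqrt_sq hv]
  calc v ^ 2 * |d₃| ≤ v ^ 2 * (2 * v * √d₂ ^ 3) := by gcongr
    _ = 2 * (v * √d₂) ^ 3 := by ring

theorem abs_sq_mul_le_sqrt_mul_rpow {d₁ d₂ : ℝ} (hν : 0 ≤ ν) (hd₂ : 0 ≤ d₂)
    (h : d₁ ^ 2 ≤ ν * d₂) : |v ^ 2 * d₁| ≤ √(ν * v ^ 2) * |v ^ 2 * d₂| ^ (1 / 2 : ℝ) := by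
  rw [abs_of_nonneg (by positivity : 0 ≤ v ^ 2 * d₂), ← Real.sqrt_eq_rpow,
    ← Real.sqrt_mul (by positivity)]
  refine Real.abs_le_sqrt ?_
  calc (v ^ 2 * d₁) ^ 2 = v ^ 4 * d₁ ^ 2 := by ring
    _ ≤ v ^ 4 * (ν * d₂) := by gcongr
    _ = ν * v ^ 2 * (v ^ 2 * d₂) := by ring

theorem IsBarrier.isSelfConcordantBarrier (hφ : IsBarrier K φ) (hv : 0 < v) (hν : 0 ≤ ν)
    (hsecond : ∀ x ∈ K, ∀ h, 0 ≤ iteratedFDeriv ℝ 2 φ x ![h, h])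
    (hthird : ∀ x ∈ K, ∀ h, |iteratedFDeriv ℝ 3 φ x ![h, h, h]| ≤
      2 * v * √(iteratedFDeriv ℝ 2 φ x ![h, h]) ^ 3)
    (hfirst : ∀ x ∈ K, ∀ h, fderiv ℝ φ x h ^ 2 ≤ ν * iteratedFDeriv ℝ 2 φ x ![h, h]) :
    IsSelfConcordantBarrier (ν * v ^ 2) K fun x => v ^ 2 * φ x := by
  have hdiff : ∀ x ∈ K, ContDiffAt ℝ 3 φ x := fun x hx =>
    (hφ.contDiffOn x hx).contDiffAt (hφ.isOpen.mem_nhds hx)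
  have hscale : ∀ x ∈ K, ∀ k : ℕ, (k : WithTop ℕ∞) ≤ 3 → ∀ w : Fin k → Fin n → ℝ,
      iteratedFDeriv ℝ k (fun x => v ^ 2 * φ x) x w = v ^ 2 * iteratedFDeriv ℝ k φ x w :=
    fun x hx k hk w => congrFun (congrArg DFunLike.coe
      (iteratedFDeriv_const_smul_apply' (a := v ^ 2) ((hdiff x hx).of_le hk))) w
  refine ⟨hφ.const_mul (sq_pos_of_pos hv), fun x hx h => ?_, fun x hx h => ?_⟩
  · rw [hscale x hx 3 le_rfl, hscale x hx 2 (by norm_num)]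
    exact abs_sq_mul_le_two_mul_rpow hv.le (hsecond x hx h) (hthird x hx h)
  · rw [hscale x hx 2 (by norm_num),
      fderiv_const_mul ((hdiff x hx).differentiableAt three_ne_zero)]
    exact abs_sq_mul_le_sqrt_mul_rpow hν (hsecond x hx h) (hfirst x hx h)

end Scaling

end LewisBarrier

end

theorem mainTheorem4 {m n : ℕ} (A : Matrix (Fin m) (Fin n) ℝ) (b : Fin m → ℝ)
    (hA : LewisBarrier.NonDegenerate A) (hΩ : (LewisBarrier.interiorSet A b).Nonempty)
    (q : ℝ) (hq : 0 < q) :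
    -- the maximum (`q ≥ 2`) or minimum (`q ≤ 2`) defining the barrier is attained
    (∀ x ∈ LewisBarrier.interiorSet A b,
      (2 ≤ q → IsGreatest (LewisBarrier.barrierValues q A b x) (LewisBarrier.barrier q A b x)) ∧
      (q ≤ 2 → IsLeast (LewisBarrier.barrierValues q A b x) (LewisBarrier.barrier q A b x))) ∧
    LewisBarrier.IsBarrier (LewisBarrier.interiorSet A b) (LewisBarrier.barrier q A b) ∧
    (∀ x ∈ LewisBarrier.interiorSet A b,
      (LewisBarrier.hess (LewisBarrier.barrier q A b) x).PosDef ∧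
      LewisBarrier.grad (LewisBarrier.barrier q A b) x ⬝ᵥ
        ((LewisBarrier.hess (LewisBarrier.barrier q A b) x)⁻¹ *ᵥ
          LewisBarrier.grad (LewisBarrier.barrier q A b) x) ≤ n) ∧
    (∀ x ∈ LewisBarrier.interiorSet A b, ∀ h : Fin n → ℝ,
      |iteratedFDeriv ℝ 3 (LewisBarrier.barrier q A b) x ![h, h, h]| ≤
        2 * LewisBarrier.concordanceConst q m *
          √(h ⬝ᵥ (LewisBarrier.hess (LewisBarrier.barrier q A b) x *ᵥ h)) ^ 3) ∧
    LewisBarrier.IsSelfConcordantBarrier (n * LewisBarrier.concordanceConst q m ^ 2)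
      (LewisBarrier.interiorSet A b)
      (fun x => LewisBarrier.concordanceConst q m ^ 2 * LewisBarrier.barrier q A b x) := by
  refine ⟨fun x hx => ?_, LewisBarrier.isBarrier_barrier hA hq, fun x hx => ?_,
    fun x hx h => ?_, ?_⟩
  · obtain ⟨l, hl⟩ := LewisBarrier.exists_isLewis hA hq b x
    rw [hl.barrier_eq hA hx hq]
    exact ⟨hl.isGreatest hA hx, hl.isLeast hA hx hq⟩
  · refine ⟨LewisBarrier.hess_barrier_posDef hA hq hx,
      LewisBarrier.dotProduct_inv_mulVec_le (LewisBarrier.hess_barrier_posDef hA hq hx)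
        (Nat.cast_nonneg n) fun h => ?_⟩
    rw [← LewisBarrier.fderiv_eq_dotProduct, ← LewisBarrier.iteratedFDeriv_two_eq_dotProduct]
    exact LewisBarrier.first_barrier_sq_le hA hq hx h
  · rw [← LewisBarrier.iteratedFDeriv_two_eq_dotProduct]
    exact LewisBarrier.abs_third_barrier_le hA hq hx h
  · exact (LewisBarrier.isBarrier_barrier hA hq).isSelfConcordantBarrier
      (LewisBarrier.concordanceConst_pos hq) (Nat.cast_nonneg n)
      (fun _ => LewisBarrier.second_barrier_nonneg hA hq)
      (fun _ => LewisBarrier.abs_third_barrier_le hA hq)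
      (fun _ => LewisBarrier.first_barrier_sq_le hA hq)
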